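/- **Setting.** Let $\mathcal X,\mathcal Y$ be measurable spaces, $P$ a probability measure on $\mathcal X\times\mathcal Y$, $\bar{\mathcal Y}\subset\mathbb R$, and $\bar\ell:\bar{\mathcal Y}\times\mathcal Y\to\mathbb R$ a loss, measurable in its second argument, such that for some $L>0$ and every $y\in\mathcal Y$ the function $\bar\ell(\cdot,y)$ is convex and $L$-Lipschitz on $\bar{\mathcal Y}$ (a convex set). Put $\ell_f(x,y)=\bar\ell(f(x),y)$. Let $F$ be a convex class of measurable functions $f:\mathcal X\to\bar{\mathcal Y}$, let $f^*\in F$ be a minimizer of the risk over $F$, put $\mathcal L_f=\ell_f-\ell_{f^*}$ (so that $P\mathcal L_f\ge 0$ for all $f\in F$), and assume $f-f^*\in L_2(P)$ for all $f\in F$. Write $\|f-f^*\|_{L_2}=(P(f-f^*)^2)^{1/2}$. To make suprema over $F$ measurable, assume that $F$ has a countable subset $F_0$ such that each $f\in F$ is the limit, pointwise on $\mathcal X$ and in $L_2(P)$, of a sequence in $F_0$. The data $(X_i,Y_i)$, $i\in\{1,\dots,N\}$, take values in $\mathcal X\times\mathcal Y$, and $\{1,\dots,N\}=\mathcal O\cup\mathcal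 I$ is a partition with $|\mathcal O|\le 3N/7$. Nothing is assumed on $(X_i,Y_i)_{i\in\mathcal O}$. The $(X_i,Y_i)_{i\in\mathcal I}$ are independent and, if $P_i$ is the law of $(X_i,Y_i)$, then $(P_i(f-f^*)^2)^{1/2}=\|f-f^*\|_{L_2}$ and $P_i\mathcal L_f=P\mathcal L_f$ for all $i\in\mathcal I$ and $f\in F$. **Complexity.** Let $\sigma_1,\dots,\sigma_N$ be i.i.d. uniform on $\{-1,1\}$ and independent of the inliers. For $\gamma>0$ let $\tilde r_2(\gamma)$ be any real number with $$\tilde r_2(\gamma)\ \ge\ \inf\Big\{r>0:\ \forall J\subset\mathcal I \text{ with } |J|\ge \tfrac N2,\ \ \mathbb E\sup_{f\in F:\ \|f-f^*\|_{L_2}\le r}\Big|\sum_{i\in J}\sigma_i(f-f^*)(X_i)\Big|\le r^2|J|\gamma\Big\},$$ where the set on the right is assumed to be non-empty. **Estimator.** Let $1\le K\le N$ and let $B_1,\dots,B_K$ be pairwise disjoint subsets of $\{1,\dots,N\}$, each of size $\lfloor N/K\rfloor$ (a partition if $K$ divides $N$; otherwise some data are left out). For $h:\mathcal X\times\mathcal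 Y\to\mathbb R$ let $P_{B_k}h=|B_k|^{-1}\sum_{i\in B_k}h(X_i,Y_i)$ and let $\mathrm{MOM}_K[h]$ be the median of $P_{B_1}h,\dots,P_{B_K}h$ (the mean of the two middle values if $K$ is even). A minmax MOM estimator is any $$\hat f\in\operatorname*{argmin}_{f\in F}\ \sup_{g\in F}\ \mathrm{MOM}_K[\ell_f-\ell_g].$$ **Theorem.** Let $K$ be an integer with $1\le K$ and $7|\mathcal O|/3\le K\le N$, let $A>0$, put $$C_{K,r}=\max\Big(\tilde r_2^2\big(1/(575AL)\big),\ 864A^2L^2\frac KN\Big),$$ and assume the local Bernstein condition: for all $f\in F$ with $\|f-f^*\|_{L_2}^2=C_{K,r}$, one has $\|f-f^*\|_{L_2}^2\le A\,P\mathcal L_f$. Then there is an event of probability at least $1-\exp(-K/2016)$ on which every minmax MOM estimator $\hat f$ satisfies $$\|\hat f-f^*\|_{L_2}^2\le C_{K,r}\qquad\text{and}\qquad P\mathcal L_{\hat f}\le\frac{2}{3A}\,C_{K,r}.$$ -/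

import Mathlib

open MeasureTheory ProbabilityTheory Filter Topology
open scoped ENNReal

noncomputable section

/-- The loss `ℓ u y` is, on the set `Ybar` of admissible predictions `u`, convex and `L`-Lipschitz
in `u` for every `y`; it is also measurable in `y`. Only its values for `u ∈ Ybar` matter. -/
structure IsLipschitzConvexLoss {𝒴 : Type*} [MeasurableSpace 𝒴]
    (Ybar : Set ℝ) (ℓ : ℝ → 𝒴 → ℝ) (L : ℝ) : Prop where
  measurable : ∀ u ∈ Ybar, Measurable (ℓ u)
  lipschitz : ∀ y, ∀ u ∈ Ybar, ∀ v ∈ Ybar, |ℓ u y - ℓ v y| ≤ L * |u - v|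
  convex : ∀ y, ConvexOn ℝ Ybar (fun u => ℓ u y)

/-- The function `ℓ_f - ℓ_g` on `𝒳 × 𝒴`. For `g = f*` it is the excess loss of `f`. -/
def lossDiff {𝒳 𝒴 : Type*} (ℓ : ℝ → 𝒴 → ℝ) (f g : 𝒳 → ℝ) (z : 𝒳 × 𝒴) : ℝ :=
  ℓ (f z.1) z.2 - ℓ (g z.1) z.2

/-- The excess risk `Q (ℓ_f - ℓ_g) = ∫ (ℓ_f - ℓ_g) dQ`. -/
def excessRisk {𝒳 𝒴 : Type*} [MeasurableSpace 𝒳] [MeasurableSpace 𝒴]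
    (Q : Measure (𝒳 × 𝒴)) (ℓ : ℝ → 𝒴 → ℝ) (f g : 𝒳 → ℝ) : ℝ :=
  ∫ z, lossDiff ℓ f g z ∂Q

/-- `f - g` is in `L₂(Q)`, where functions on `𝒳` are seen as functions on `𝒳 × 𝒴`. -/
def SubMemL2 {𝒳 𝒴 : Type*} [MeasurableSpace 𝒳] [MeasurableSpace 𝒴]
    (Q : Measure (𝒳 × 𝒴)) (f g : 𝒳 → ℝ) : Prop :=
  MemLp (fun z : 𝒳 × 𝒴 => f z.1 - g z.1) 2 Q

/-- The distance `‖f - g‖_{L₂(Q)}`; only used when `f - g` is in `L₂(Q)`. -/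
def l2Dist {𝒳 𝒴 : Type*} [MeasurableSpace 𝒳] [MeasurableSpace 𝒴]
    (Q : Measure (𝒳 × 𝒴)) (f g : 𝒳 → ℝ) : ℝ :=
  (eLpNorm (fun z : 𝒳 × 𝒴 => f z.1 - g z.1) 2 Q).toReal

/-- The class `F` has a countable subset from which every `f ∈ F` can be approximated, pointwise
and in `L₂(Q)`, by a sequence. This is the usual condition under which suprema over `F` and over
`L₂`-balls of `F` are measurable. -/
def IsSeparableClass {𝒳 𝒴 : Type*} [MeasurableSpace 𝒳] [MeasurableSpace 𝒴]
    (Q : Measure (𝒳 × 𝒴)) (F : Set (𝒳 → ℝ)) : Prop :=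
  ∃ F₀ : Set (𝒳 → ℝ), F₀ ⊆ F ∧ F₀.Countable ∧
    ∀ f ∈ F, ∃ u : ℕ → 𝒳 → ℝ, (∀ n, u n ∈ F₀) ∧
      (∀ x, Tendsto (fun n => u n x) atTop (𝓝 (f x))) ∧
      Tendsto (fun n => eLpNorm (fun z : 𝒳 × 𝒴 => u n z.1 - f z.1) 2 Q) atTop (𝓝 0)

/-- The oracle: `fs` is in `F` and minimizes the risk over `F`, the risk being defined through the
differences `ℓ_f - ℓ_fs`. -/
def IsOracle {𝒳 𝒴 : Type*} [MeasurableSpace 𝒳] [MeasurableSpace 𝒴]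
    (P : Measure (𝒳 × 𝒴)) (ℓ : ℝ → 𝒴 → ℝ) (F : Set (𝒳 → ℝ)) (fs : 𝒳 → ℝ) : Prop :=
  fs ∈ F ∧ ∀ f ∈ F, 0 ≤ excessRisk P ℓ f fs

/-- The inliers `(Z i)`, `i ∈ I`, are independent random variables, and their laws `P_i` give to
`f - fs` the same `L₂` norm and to `f` the same excess risk as `P` does, for all `f ∈ F`. -/
structure AreInliers {Ω 𝒳 𝒴 : Type*} [MeasurableSpace Ω] [MeasurableSpace 𝒳] [MeasurableSpace 𝒴]
    (Pr : Measure Ω) (P : Measure (𝒳 × 𝒴)) (ℓ : ℝ → 𝒴 → ℝ) (F : Set (𝒳 → ℝ)) (fs : 𝒳 → ℝ)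
    {N : ℕ} (Z : Fin N → Ω → 𝒳 × 𝒴) (I : Finset (Fin N)) : Prop where
  measurable : ∀ i ∈ I, Measurable (Z i)
  indep : iIndepFun (fun i : I => Z i) Pr
  memL2 : ∀ i ∈ I, ∀ f ∈ F, SubMemL2 (Pr.map (Z i)) f fs
  l2Dist_eq : ∀ i ∈ I, ∀ f ∈ F, l2Dist P f fs = l2Dist (Pr.map (Z i)) f fs
  excessRisk_eq : ∀ i ∈ I, ∀ f ∈ F, excessRisk (Pr.map (Z i)) ℓ f fs = excessRisk P ℓ f fs

/-- The local Rademacher complexity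
`E sup { |∑ i ∈ J, σ_i (f - fs)(X_i)| : f ∈ F, ‖f - fs‖_{L₂(P)} ≤ r }`.
The signs `σ_i` are i.i.d. uniform on `{-1, 1}` and independent of the data, so the expectation
over them is the average over all `2 ^ N` sign vectors. -/
def rademacherComplexity {Ω 𝒳 𝒴 : Type*}
    [MeasurableSpace Ω] [MeasurableSpace 𝒳] [MeasurableSpace 𝒴]
    (Pr : Measure Ω) (P : Measure (𝒳 × 𝒴)) (F : Set (𝒳 → ℝ)) (fs : 𝒳 → ℝ)
    {N : ℕ} (Z : Fin N → Ω → 𝒳 × 𝒴) (J : Finset (Fin N)) (r : ℝ) : ℝ≥0∞ :=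
  (∑ σ : Fin N → ℤˣ, ∫⁻ ω, ⨆ f ∈ {f ∈ F | l2Dist P f fs ≤ r},
    ENNReal.ofReal |∑ i ∈ J, ((σ i : ℤ) : ℝ) * (f (Z i ω).1 - fs (Z i ω).1)| ∂Pr) / 2 ^ N

/-- The radii `r > 0` at which the local Rademacher complexity is at most `r² |J| γ` for all sets
`J` of at least `N / 2` inliers. -/
def complexityRadii {Ω 𝒳 𝒴 : Type*}
    [MeasurableSpace Ω] [MeasurableSpace 𝒳] [MeasurableSpace 𝒴]
    (Pr : Measure Ω) (P : Measure (𝒳 × 𝒴)) (F : Set (𝒳 → ℝ)) (fs : 𝒳 → ℝ)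
    {N : ℕ} (Z : Fin N → Ω → 𝒳 × 𝒴) (I : Finset (Fin N)) (γ : ℝ) : Set ℝ :=
  {r | 0 < r ∧ ∀ J ⊆ I, (N : ℝ) / 2 ≤ J.card →
    rademacherComplexity Pr P F fs Z J r ≤ ENNReal.ofReal (r ^ 2 * J.card * γ)}

/-- `r₂` is an admissible value of the complexity parameter at `γ`: a real number that is at least
the infimum of `complexityRadii` (which is `+∞` if there are no such radii). -/
def IsComplexityParameter {Ω 𝒳 𝒴 : Type*}
    [MeasurableSpace Ω] [MeasurableSpace 𝒳] [MeasurableSpace 𝒴]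
    (Pr : Measure Ω) (P : Measure (𝒳 × 𝒴)) (F : Set (𝒳 → ℝ)) (fs : 𝒳 → ℝ)
    {N : ℕ} (Z : Fin N → Ω → 𝒳 × 𝒴) (I : Finset (Fin N)) (γ r₂ : ℝ) : Prop :=
  (complexityRadii Pr P F fs Z I γ).Nonempty ∧ sInf (complexityRadii Pr P F fs Z I γ) ≤ r₂

/-- The squared radius `C_{K,r} = max (r₂ ^ 2, 864 A ^ 2 L ^ 2 K / N)`. -/
def squaredRadius (A L : ℝ) (K N : ℕ) (r₂ : ℝ) : ℝ :=
  max (r₂ ^ 2) (864 * A ^ 2 * L ^ 2 * (K / N))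

/-- The median of `K` real numbers: the midpoint of the interval of their medians, that is, the
middle order statistic if `K` is odd and the mean of the two middle ones if `K` is even. -/
def median {K : ℕ} (a : Fin K → ℝ) : ℝ :=
  (sInf {t : ℝ | K ≤ 2 * (Finset.univ.filter fun k => a k ≤ t).card} +
    sSup {t : ℝ | K ≤ 2 * (Finset.univ.filter fun k => t ≤ a k).card}) / 2

/-- `K` pairwise disjoint blocks of indices in `{1, …, N}`, all of size `⌊N / K⌋`; if `K` divides
`N` this is a partition, otherwise some data are left out. -/
structure AreBlocks {N K : ℕ} (B : Fin K → Finset (Fin N)) : Prop where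
  disjoint : Pairwise fun k l => Disjoint (B k) (B l)
  card_eq : ∀ k, (B k).card = N / K

/-- The median of means `MOM_K[h]` of `h` over the blocks `B`, for the data `z`. -/
def medianOfMeans {𝒵 : Type*} {N K : ℕ} (B : Fin K → Finset (Fin N)) (z : Fin N → 𝒵)
    (h : 𝒵 → ℝ) : ℝ :=
  median fun k => (∑ i ∈ B k, h (z i)) / (B k).card

/-- The minmax criterion `sup_{g ∈ F} MOM_K[ℓ_f - ℓ_g]`, possibly `+∞`. -/
def minmaxCriterion {𝒳 𝒴 : Type*} (ℓ : ℝ → 𝒴 → ℝ) (F : Set (𝒳 → ℝ)) {N K : ℕ}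
    (B : Fin K → Finset (Fin N)) (z : Fin N → 𝒳 × 𝒴) (f : 𝒳 → ℝ) : EReal :=
  ⨆ g ∈ F, ((medianOfMeans B z (lossDiff ℓ f g) : ℝ) : EReal)

/-- `fhat` is a minmax MOM estimator for the data `z`: a minimizer over `F` of the criterion. -/
def IsMinmaxMOM {𝒳 𝒴 : Type*} (ℓ : ℝ → 𝒴 → ℝ) (F : Set (𝒳 → ℝ)) {N K : ℕ}
    (B : Fin K → Finset (Fin N)) (z : Fin N → 𝒳 × 𝒴) (fhat : 𝒳 → ℝ) : Prop :=
  fhat ∈ F ∧ ∀ f ∈ F, minmaxCriterion ℓ F B z fhat ≤ minmaxCriterion ℓ F B z f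

/-- The local Bernstein condition with constant `A` on the sphere of squared radius `C` around
`fs`. -/
def LocalBernstein {𝒳 𝒴 : Type*} [MeasurableSpace 𝒳] [MeasurableSpace 𝒴]
    (P : Measure (𝒳 × 𝒴)) (ℓ : ℝ → 𝒴 → ℝ) (F : Set (𝒳 → ℝ)) (fs : 𝒳 → ℝ) (A C : ℝ) : Prop :=
  ∀ f ∈ F, l2Dist P f fs ^ 2 = C → l2Dist P f fs ^ 2 ≤ A * excessRisk P ℓ f fs

end

/-! Deterministic half. Suppose that for every `f` in the ball `‖f - fs‖² ≤ C` a strict majority of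
the blocks has mean excess loss within `C / (3A)` of the excess risk. For `f` outside the ball, let
`f₀` be the point where the segment from `fs` to `f` crosses the sphere. The Bernstein condition
makes the excess risk of `f₀` at least `C / A`, so most block means at `f₀` are at least `2C /
(3A)`, and convexity of the loss carries this bound over to `f`. Hence the criterion at `fs` is at
most `C / (3A)`, while outside the ball it is at least `2C / (3A)`: a minimizer lies inside. There
its excess risk exceeds the median by at most `C / (3A)`. This is `IsMinmaxMOM.localized`.

Probabilistic half. The clean blocks with a large deviation are counted through `ramp`, a Lipschitz
majorant of the indicator. The sum of ramps over the clean blocks is controlled uniformly over the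
ball by three terms: individual means, by the variance of a block mean; the fluctuation of the
supremum, by McDiarmid's inequality with the blocks as independent coordinates; and the expected
supremum of the centered sum. The last is bounded by symmetrizing over blocks, contracting away
`ramp`, symmetrizing over data points and contracting away the loss, which leaves the local
Rademacher complexity of `F` (`integral_iSup_sum_ramp_le`, `measureReal_exists_sum_ramp_gt_le`). All
this is done for finite subclasses, then passes to a countable one by monotone limits and to the
whole ball by density.

Balance of constants: each outlier spoils at most one block, so at least `4K/7` blocks are clean; at
most `3/25` of these deviate, and `22/25 · 4/7 = 88/175 > 1/2`. -/

/-! ### Contraction principle for Rademacher averages -/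

section Signs

variable {ι T : Type*}

/-- The sign vector `σ` with its `j`-th sign reversed. -/
def flipSign [DecidableEq ι] (j : ι) (σ : ι → ℤˣ) : ι → ℤˣ :=
  σ * Pi.mulSingle j (-1)

lemma sum_signs_flip [Fintype ι] [DecidableEq ι] {M : Type*} [AddCommMonoid M] (j : ι)
    (H : (ι → ℤˣ) → M) :
    ∑ σ : ι → ℤˣ, H (flipSign j σ) = ∑ σ : ι → ℤˣ, H σ :=
  Equiv.sum_comp (Equiv.mulRight (Pi.mulSingle j (-1 : ℤˣ) : ι → ℤˣ)) H

lemma flipSign_self [DecidableEq ι] (σ : ι → ℤˣ) (j : ι) : flipSign j σ j = -σ j := by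
  simp [flipSign]

lemma flipSign_of_ne [DecidableEq ι] (σ : ι → ℤˣ) {i j : ι} (h : i ≠ j) :
    flipSign j σ i = σ i := by
  simp [flipSign, h]

/-- One sign, averaged out. For a pair `s, t`, `v s - v t` is at most `w s - w t` or `w t - w s`; in
the second case `s` and `t` exchange roles in the two suprema. -/
lemma iSup_add_iSup_contraction [Finite T] [Nonempty T] {a v w : T → ℝ}
    (h : ∀ s t, |v s - v t| ≤ |w s - w t|) :
    (⨆ t, (a t + v t)) + (⨆ t, (a t - v t)) ≤ (⨆ t, (a t + w t)) + ⨆ t, (a t - w t) := by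
  have key : ∀ s t, (a s + v s) + (a t - v t) ≤ (⨆ t, (a t + w t)) + ⨆ t, (a t - w t) := by
    intro s t
    have h1 := le_ciSup (Set.finite_range fun t => a t + w t).bddAbove
    have h2 := le_ciSup (Set.finite_range fun t => a t - w t).bddAbove
    have h3 := (le_abs_self _).trans (h s t)
    rcases abs_cases (w s - w t) with hc | hc
    · linarith [h1 s, h2 t]
    · linarith [h1 t, h2 s]
  have : (⨆ t, (a t + v t)) ≤
      (⨆ t, (a t + w t)) + (⨆ t, (a t - w t)) - ⨆ t, (a t - v t) := by
    refine ciSup_le fun s => ?_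
    have : (⨆ t, (a t - v t)) ≤
        (⨆ t, (a t + w t)) + (⨆ t, (a t - w t)) - (a s + v s) :=
      ciSup_le fun t => by linarith [key s t]
    linarith
  linarith

lemma iSup_add_sign_mul_add (u : ℤˣ) (a v : T → ℝ) :
    (⨆ t, (a t + ((u : ℤ) : ℝ) * v t)) + (⨆ t, (a t + (((-(u : ℤ)) : ℤ) : ℝ) * v t)) =
      (⨆ t, (a t + v t)) + ⨆ t, (a t - v t) := by
  rcases Int.units_eq_one_or u with rfl | rfl
  · simp [sub_eq_add_neg]
  · simp [sub_eq_add_neg, add_comm]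

/-- Pairing each `σ` with its flip at `j` turns twice the sum into a sum of pairs with opposite
`j`-th signs, to which the one-sign inequality applies. -/
lemma sum_signs_iSup_le_single [Fintype ι] [DecidableEq ι] [Finite T] [Nonempty T] (j : ι)
    (a : (ι → ℤˣ) → T → ℝ)
    (ha : ∀ σ t, a (flipSign j σ) t = a σ t) {v w : T → ℝ}
    (h : ∀ s t, |v s - v t| ≤ |w s - w t|) :
    ∑ σ : ι → ℤˣ, ⨆ t, (a σ t + ((σ j : ℤ) : ℝ) * v t) ≤
      ∑ σ : ι → ℤˣ, ⨆ t, (a σ t + ((σ j : ℤ) : ℝ) * w t) := by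
  have key : ∀ x : T → ℝ, 2 * ∑ σ : ι → ℤˣ, ⨆ t, (a σ t + ((σ j : ℤ) : ℝ) * x t) =
      ∑ σ : ι → ℤˣ, ((⨆ t, (a σ t + x t)) + ⨆ t, (a σ t - x t)) := by
    intro x
    rw [two_mul]
    conv_lhs =>
      enter [2]
      rw [← sum_signs_flip j]
    rw [← Finset.sum_add_distrib]
    refine Finset.sum_congr rfl fun σ _ => ?_
    simp only [ha, flipSign_self, Units.val_neg]
    exact iSup_add_sign_mul_add (σ j) (a σ) x
  have := Finset.sum_le_sum fun (σ : ι → ℤˣ) (_ : σ ∈ Finset.univ) =>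
    iSup_add_iSup_contraction (a := a σ) h
  rw [← key, ← key] at this
  linarith

/-- The contraction principle for Rademacher averages, in terms of the values taken. -/
theorem sum_signs_iSup_le [Fintype ι] [DecidableEq ι] [Finite T] [Nonempty T]
    {v w : T → ι → ℝ} (h : ∀ i s t, |v s i - v t i| ≤ |w s i - w t i|) :
    ∑ σ : ι → ℤˣ, ⨆ t, ∑ i, ((σ i : ℤ) : ℝ) * v t i ≤
      ∑ σ : ι → ℤˣ, ⨆ t, ∑ i, ((σ i : ℤ) : ℝ) * w t i := by
  -- The coordinates are exchanged one at a time; `S` collects those where `w` has already replaced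
  -- `v`.
  suffices H : ∀ S : Finset ι, ∑ σ : ι → ℤˣ, ⨆ t, ∑ i, ((σ i : ℤ) : ℝ) * v t i ≤
      ∑ σ : ι → ℤˣ, ⨆ t, ∑ i, ((σ i : ℤ) : ℝ) * (if i ∈ S then w t i else v t i) by
    simpa using H Finset.univ
  intro S
  induction S using Finset.induction_on with
  | empty => simp
  | insert j S hj ih =>
    refine ih.trans ?_
    have := sum_signs_iSup_le_single j
      (fun σ t => ∑ i ∈ Finset.univ.erase j,
        ((σ i : ℤ) : ℝ) * (if i ∈ S then w t i else v t i)) (fun σ t => by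
          refine Finset.sum_congr rfl fun i hi => ?_
          rw [flipSign_of_ne σ (Finset.ne_of_mem_erase hi)]) (h j)
    refine le_of_eq_of_le ?_ (this.trans (le_of_eq ?_))
    · refine Finset.sum_congr rfl fun σ _ => iSup_congr fun t => ?_
      rw [← Finset.sum_erase_add _ _ (Finset.mem_univ j), if_neg hj]
    · refine Finset.sum_congr rfl fun σ _ => iSup_congr fun t => ?_
      rw [← Finset.sum_erase_add _ _ (Finset.mem_univ j), if_pos (Finset.mem_insert_self j S)]
      congr 1
      refine Finset.sum_congr rfl fun i hi => ?_
      simp [Finset.ne_of_mem_erase hi]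

end Signs

/-! ### Jensen's inequality and one-coordinate symmetrization for finite suprema -/

section FiniteSup

variable {Ω T : Type*} [MeasurableSpace Ω] {μ : Measure Ω}

lemma abs_iSup_le_sum {T : Type*} [Fintype T] (f : T → ℝ) : |⨆ t, f t| ≤ ∑ t, |f t| := by
  cases isEmpty_or_nonempty T
  · simp
  have hle : ∀ t, |f t| ≤ ∑ t, |f t| := fun t =>
    Finset.single_le_sum (f := fun t => |f t|) (fun _ _ => abs_nonneg _) (Finset.mem_univ t)
  rw [abs_le]
  refine ⟨?_, ciSup_le fun t => (le_abs_self _).trans (hle t)⟩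
  obtain ⟨t⟩ := ‹Nonempty T›
  have := le_ciSup (Set.finite_range f).bddAbove t
  linarith [hle t, neg_abs_le (f t)]

lemma Integrable.iSup_finite [Finite T] {f : T → Ω → ℝ} (hf : ∀ t, Integrable (f t) μ) :
    Integrable (fun ω => ⨆ t, f t ω) μ := by
  cases nonempty_fintype T
  refine Integrable.mono' (g := fun ω => ∑ t, |f t ω|)
    (integrable_finsetSum _ fun t _ => (hf t).abs) ?_ (ae_of_all _ fun ω => ?_)
  · exact (AEMeasurable.iSup fun t => (hf t).aemeasurable).aestronglyMeasurable
  · exact abs_iSup_le_sum fun t => f t ω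

lemma iSup_integral_le [Finite T] [Nonempty T] {f : T → Ω → ℝ} (hf : ∀ t, Integrable (f t) μ) :
    ⨆ t, ∫ ω, f t ω ∂μ ≤ ∫ ω, ⨆ t, f t ω ∂μ :=
  ciSup_le fun t => integral_mono (hf t) (Integrable.iSup_finite hf) fun ω =>
    le_ciSup (f := fun t => f t ω) (Set.finite_range _).bddAbove t

/-- Jensen's inequality for a finite supremum, conditionally on an independent vector. -/
lemma integral_iSup_add_integral_le [Finite T] [Nonempty T] [IsProbabilityMeasure μ]
    {X Y : Ω → T → ℝ}
    (hX : Measurable X) (hY : Measurable Y) (hXi : ∀ t, Integrable (fun ω => X ω t) μ)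
    (hYi : ∀ t, Integrable (fun ω => Y ω t) μ) (hXY : IndepFun X Y μ) :
    ∫ ω, ⨆ t, (Y ω t + ∫ ω', X ω' t ∂μ) ∂μ ≤ ∫ ω, ⨆ t, (Y ω t + X ω t) ∂μ := by
  have hprod := (indepFun_iff_map_prod_eq_prod_map_map hX.aemeasurable hY.aemeasurable).1 hXY
  have := Measure.isProbabilityMeasure_map (μ := μ) hX.aemeasurable
  have := Measure.isProbabilityMeasure_map (μ := μ) hY.aemeasurable
  have hmeas : Measurable fun p : (T → ℝ) × (T → ℝ) => ⨆ t, (p.2 t + p.1 t) :=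
    Measurable.iSup fun t => by fun_prop
  have hXi' : ∀ t, Integrable (fun x : T → ℝ => x t) (μ.map X) := fun t =>
    (integrable_map_measure (measurable_pi_apply t).aestronglyMeasurable hX.aemeasurable).2 (hXi t)
  have hYi' : ∀ t, Integrable (fun x : T → ℝ => x t) (μ.map Y) := fun t =>
    (integrable_map_measure (measurable_pi_apply t).aestronglyMeasurable hY.aemeasurable).2 (hYi t)
  have hpi : Integrable (fun p : (T → ℝ) × (T → ℝ) => ⨆ t, (p.2 t + p.1 t))
      ((μ.map X).prod (μ.map Y)) :=
    Integrable.iSup_finite fun t => ((hYi' t).comp_snd _).add ((hXi' t).comp_fst _)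
  have hm : ∀ t, ∫ ω', X ω' t ∂μ = ∫ x, x t ∂(μ.map X) := fun t => by
    rw [integral_map hX.aemeasurable (measurable_pi_apply t).aestronglyMeasurable]
  have e1 : ∫ ω, ⨆ t, (Y ω t + X ω t) ∂μ =
      ∫ y, ∫ x, ⨆ t, (y t + x t) ∂(μ.map X) ∂(μ.map Y) := by
    rw [← integral_prod_symm _ hpi, ← hprod,
      integral_map (hX.prodMk hY).aemeasurable hmeas.aestronglyMeasurable]
  have e2 : ∫ ω, ⨆ t, (Y ω t + ∫ ω', X ω' t ∂μ) ∂μ =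
      ∫ y, ⨆ t, (y t + ∫ x, x t ∂(μ.map X)) ∂(μ.map Y) := by
    simp only [hm]
    rw [integral_map hY.aemeasurable (Measurable.aestronglyMeasurable
      (Measurable.iSup fun t => by fun_prop))]
  rw [e1, e2]
  refine integral_mono (Integrable.iSup_finite fun t => (hYi' t).add (integrable_const _))
    hpi.integral_prod_right fun y => ?_
  refine le_of_eq_of_le ?_ (iSup_integral_le fun t => (integrable_const (y t)).add (hXi' t))
  refine iSup_congr fun t => ?_
  simp [integral_add (integrable_const (y t)) (hXi' t)]

/-- Symmetrization without a ghost copy: `Y + X - 𝔼X` is the midpoint of `Y + 2X` and `Y - 2𝔼X`, so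
its supremum is at most the mean of theirs, and Jensen's inequality replaces `-2𝔼X` by `-2X`. -/
lemma integral_iSup_centered_le [Finite T] [Nonempty T] [IsProbabilityMeasure μ]
    {X Y : Ω → T → ℝ}
    (hX : Measurable X) (hY : Measurable Y) (hXi : ∀ t, Integrable (fun ω => X ω t) μ)
    (hYi : ∀ t, Integrable (fun ω => Y ω t) μ) (hXY : IndepFun X Y μ) :
    2 * ∫ ω, ⨆ t, (Y ω t + (X ω t - ∫ ω', X ω' t ∂μ)) ∂μ ≤
      (∫ ω, ⨆ t, (Y ω t + 2 * X ω t) ∂μ) + ∫ ω, ⨆ t, (Y ω t - 2 * X ω t) ∂μ := by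
  have hX2 : Measurable fun ω t => -2 * X ω t := by fun_prop
  have h1 := integral_iSup_add_integral_le (X := fun ω t => -2 * X ω t) (Y := Y)
    hX2 hY (fun t => (hXi t).const_mul _) hYi
    (hXY.comp (φ := fun (x : T → ℝ) t => -2 * x t) (ψ := id) (by fun_prop) measurable_id)
  have i1 : Integrable (fun ω => ⨆ t, (Y ω t + 2 * X ω t)) μ :=
    Integrable.iSup_finite fun t => (hYi t).add ((hXi t).const_mul 2)
  have i2 : Integrable (fun ω => ⨆ t, (Y ω t + ∫ ω', -2 * X ω' t ∂μ)) μ :=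
    Integrable.iSup_finite fun t => (hYi t).add (integrable_const _)
  have i3 : Integrable (fun ω => ⨆ t, (Y ω t + (X ω t - ∫ ω', X ω' t ∂μ))) μ :=
    Integrable.iSup_finite fun t => (hYi t).add ((hXi t).sub (integrable_const _))
  have h2 : 2 * ∫ ω, ⨆ t, (Y ω t + (X ω t - ∫ ω', X ω' t ∂μ)) ∂μ ≤
      (∫ ω, ⨆ t, (Y ω t + 2 * X ω t) ∂μ) + ∫ ω, ⨆ t, (Y ω t + ∫ ω', -2 * X ω' t ∂μ) ∂μ := by
    rw [← integral_const_mul, ← integral_add i1 i2]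
    refine integral_mono (i3.const_mul 2) (i1.add i2) fun ω => ?_
    have b1 := le_ciSup (Set.finite_range fun t => Y ω t + 2 * X ω t).bddAbove
    have b2 := le_ciSup (Set.finite_range fun t => Y ω t + ∫ ω', -2 * X ω' t ∂μ).bddAbove
    suffices ⨆ t, (Y ω t + (X ω t - ∫ ω', X ω' t ∂μ)) ≤
        ((⨆ t, (Y ω t + 2 * X ω t)) + ⨆ t, (Y ω t + ∫ ω', -2 * X ω' t ∂μ)) / 2 by
      linarith
    refine ciSup_le fun t => ?_
    have e : ∫ ω', -2 * X ω' t ∂μ = -2 * ∫ ω', X ω' t ∂μ := integral_const_mul _ _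
    have := b2 t
    simp only [e] at this ⊢
    linarith [b1 t]
  refine h2.trans (add_le_add le_rfl (h1.trans (le_of_eq ?_)))
  refine integral_congr_ae (ae_of_all _ fun ω => iSup_congr fun t => ?_)
  ring

end FiniteSup

/-! ### Symmetrization of sums of independent vectors -/

section Symmetrization

variable {Ω ι T : Type*} [MeasurableSpace Ω] {μ : Measure Ω} [Fintype ι] [DecidableEq ι]
  [Finite T] [Nonempty T]

/-- Symmetrization for finite suprema of sums of independent random vectors. -/
theorem integral_iSup_sum_centered_le [IsProbabilityMeasure μ] {X : ι → Ω → T → ℝ}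
    (hX : ∀ i, Measurable (X i)) (hXi : ∀ i t, Integrable (fun ω => X i ω t) μ)
    (hind : iIndepFun X μ) :
    2 ^ Fintype.card ι * ∫ ω, ⨆ t, ∑ i, (X i ω t - ∫ ω', X i ω' t ∂μ) ∂μ ≤
      ∑ σ : ι → ℤˣ, ∫ ω, ⨆ t, ∑ i, ((σ i : ℤ) : ℝ) * (2 * X i ω t) ∂μ := by
  -- Hybrid summands: symmetrized on `S`, still centered off `S`. Each induction step moves one
  -- index into `S`, the other summands forming the independent vector `Y`.
  let W (S : Finset ι) (σ : ι → ℤˣ) (i : ι) (x : T → ℝ) (t : T) : ℝ :=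
    if i ∈ S then ((σ i : ℤ) : ℝ) * (2 * x t) else x t - ∫ ω', X i ω' t ∂μ
  have hW : ∀ S σ i, Measurable (W S σ i) := by
    intro S σ i
    refine measurable_pi_lambda _ fun t => ?_
    by_cases h : i ∈ S <;> simp only [W, h, if_true, if_false] <;> fun_prop
  have hWi : ∀ S σ i t, Integrable (fun ω => W S σ i (X i ω) t) μ := by
    intro S σ i t
    by_cases h : i ∈ S <;> simp only [W, h, if_true, if_false]
    · exact ((hXi i t).const_mul 2).const_mul _
    · exact (hXi i t).sub (integrable_const _)
  suffices H : ∀ S : Finset ι,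
      2 ^ Fintype.card ι * ∫ ω, ⨆ t, ∑ i, (X i ω t - ∫ ω', X i ω' t ∂μ) ∂μ ≤
      ∑ σ : ι → ℤˣ, ∫ ω, ⨆ t, ∑ i, W S σ i (X i ω) t ∂μ by
    simpa [W] using H Finset.univ
  intro S
  induction S using Finset.induction_on with
  | empty => simp [W]
  | insert j S hj ih =>
    refine ih.trans ?_
    let Y (σ : ι → ℤˣ) (ω : Ω) (t : T) : ℝ := ∑ i ∈ Finset.univ.erase j, W S σ i (X i ω) t
    have hind2 : ∀ σ, IndepFun (X j) (Y σ) μ := by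
      intro σ
      have hψ : Measurable fun (x : ↥(Finset.univ.erase j) → T → ℝ) t =>
          ∑ i : (Finset.univ.erase j : Finset ι), W S σ i (x i) t :=
        measurable_pi_lambda _ fun t => Finset.measurable_sum _ fun i _ =>
          measurable_pi_iff.1 ((hW S σ i).comp (measurable_pi_apply i)) t
      have := hind.indepFun_finset {j} (Finset.univ.erase j) (by simp) hX
      exact this.comp (φ := fun x => x ⟨j, Finset.mem_singleton_self j⟩)
        (ψ := fun x t => ∑ i : (Finset.univ.erase j : Finset ι), W S σ i (x i) t)
        (by fun_prop) hψ
        |>.congr (ae_eq_refl _) (ae_of_all _ fun ω => funext fun t => by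
          simp only [Function.comp, Y]
          exact Finset.sum_coe_sort (Finset.univ.erase j) (fun i => W S σ i (X i ω) t))
    have hYm : ∀ σ, Measurable (Y σ) := fun σ =>
      measurable_pi_lambda _ fun t => Finset.measurable_sum _ fun i _ =>
        (measurable_pi_apply t).comp ((hW S σ i).comp (hX i))
    have hstep : ∀ σ, 2 * ∫ ω, ⨆ t, ∑ i, W S σ i (X i ω) t ∂μ ≤
        (∫ ω, ⨆ t, ∑ i, W (insert j S) σ i (X i ω) t ∂μ) +
        ∫ ω, ⨆ t, ∑ i, W (insert j S) (flipSign j σ) i (X i ω) t ∂μ := by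
      intro σ
      have key := integral_iSup_centered_le (hX j) (hYm σ) (hXi j)
        (fun t => integrable_finsetSum _ fun i _ => hWi S σ i t) (hind2 σ)
      have e0 : ∀ ω t, ∑ i, W S σ i (X i ω) t =
          Y σ ω t + (X j ω t - ∫ ω', X j ω' t ∂μ) := by
        intro ω t
        rw [← Finset.sum_erase_add _ _ (Finset.mem_univ j)]
        simp [W, Y, hj]
      have e1 : ∀ τ : ι → ℤˣ, (∀ i, i ≠ j → τ i = σ i) → ∀ ω t,
          ∑ i, W (insert j S) τ i (X i ω) t = Y σ ω t + ((τ j : ℤ) : ℝ) * (2 * X j ω t) := by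
        intro τ hτ ω t
        rw [← Finset.sum_erase_add _ _ (Finset.mem_univ j)]
        congr 1
        · refine Finset.sum_congr rfl fun i hi => ?_
          have hne := Finset.ne_of_mem_erase hi
          simp [W, hne, hτ i hne]
        · simp [W]
      simp only [e0, e1 σ fun _ _ => rfl, e1 (flipSign j σ) fun i hi => flipSign_of_ne σ hi]
      rcases Int.units_eq_one_or (σ j) with h | h
      · simpa [h, flipSign_self, sub_eq_add_neg] using key
      · simpa [h, flipSign_self, sub_eq_add_neg, add_comm] using key
    have := Finset.sum_le_sum fun (σ : ι → ℤˣ) (_ : σ ∈ Finset.univ) => hstep σ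
    rw [Finset.sum_add_distrib, ← Finset.mul_sum, sum_signs_flip j fun τ =>
      ∫ ω, ⨆ t, ∑ i, W (insert j S) τ i (X i ω) t ∂μ] at this
    linarith

end Symmetrization

/-! ### McDiarmid's inequality -/

section BoundedDifferences

variable {α : Type*}

/-- Hoeffding's lemma: the values lie in an interval of length `1` starting at the infimum, hence
the variance proxy `(1/2)²`. -/
lemma hasSubgaussianMGF_of_abs_sub_le_one [MeasurableSpace α] {μ : Measure α} [IsProbabilityMeasure μ]
    {g : α → ℝ}
    (hg : Measurable g) (h : ∀ x y, |g x - g y| ≤ 1) :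
    HasSubgaussianMGF (fun x => g x - ∫ y, g y ∂μ) (1 / 4) μ := by
  obtain ⟨x₀⟩ := nonempty_of_isProbabilityMeasure μ
  have hbdd : BddBelow (Set.range g) := ⟨g x₀ - 1, by
    rintro _ ⟨x, rfl⟩
    linarith [(abs_le.1 (h x x₀)).1]⟩
  have hmem : ∀ x, g x ∈ Set.Icc (⨅ y, g y) ((⨅ y, g y) + 1) := fun x => by
    have : Nonempty α := ⟨x₀⟩
    refine ⟨ciInf_le hbdd x, ?_⟩
    have : g x - 1 ≤ ⨅ y, g y := le_ciInf fun y => by linarith [(abs_le.1 (h x y)).2]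
    linarith
  have := hasSubgaussianMGF_of_mem_Icc (μ := μ) hg.aemeasurable (ae_of_all _ hmem)
  have e : ((‖(⨅ y, g y) + 1 - ⨅ y, g y‖₊ / 2) ^ 2 : NNReal) = 1 / 4 := by
    simp only [add_sub_cancel_left, nnnorm_one]
    norm_num
  rwa [e] at this

lemma exists_bound_of_bounded_differences {n : ℕ} {f : (Fin n → α) → ℝ}
    (h : ∀ x i y, |f x - f (Function.update x i y)| ≤ 1) (x z : Fin n → α) :
    |f x - f z| ≤ n := by
  suffices H : ∀ S : Finset (Fin n), |f x - f (S.piecewise z x)| ≤ S.card by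
    simpa using H Finset.univ
  intro S
  induction S using Finset.induction_on with
  | empty => simp
  | insert j S hj ih =>
    rw [Finset.piecewise_insert, Finset.card_insert_of_notMem hj]
    push_cast
    calc _ ≤ |f x - f (S.piecewise z x)| + _ := abs_sub_le _ _ _
      _ ≤ _ := add_le_add ih (h _ j (z j))

/-- McDiarmid's inequality on a product of probability spaces. -/
theorem hasSubgaussianMGF_pi_of_bounded_differences [MeasurableSpace α] {n : ℕ}
    (μ : Fin n → Measure α) [∀ i, IsProbabilityMeasure (μ i)] {f : (Fin n → α) → ℝ} (hf : Measurable f)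
    (h : ∀ x i y, |f x - f (Function.update x i y)| ≤ 1) :
    HasSubgaussianMGF (fun x => f x - ∫ y, f y ∂(Measure.pi μ)) (n / 4) (Measure.pi μ) := by
  have hbound := exists_bound_of_bounded_differences h
  have hintexp : ∀ (c t : ℝ), Integrable (fun x => Real.exp (t * (f x - c))) (Measure.pi μ) := by
    intro c t
    obtain ⟨x₀⟩ := nonempty_of_isProbabilityMeasure (Measure.pi μ)
    refine Integrable.of_bound (C := Real.exp (|t| * (n + |f x₀ - c|))) (by fun_prop)
      (ae_of_all _ fun x => ?_)
    rw [Real.norm_eq_abs, Real.abs_exp]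
    refine Real.exp_le_exp.2 ((le_abs_self _).trans ?_)
    rw [abs_mul]
    refine mul_le_mul_of_nonneg_left ?_ (abs_nonneg _)
    calc |f x - c| ≤ |f x - f x₀| + |f x₀ - c| := abs_sub_le _ _ _
      _ ≤ _ := by linarith [hbound x x₀]
  refine ⟨hintexp _, fun t => ?_⟩
  induction n with
  | zero =>
    have : ∀ x, f x = ∫ y, f y ∂(Measure.pi μ) := fun x => by
      have : ∀ y, f y = f x := fun y => congrArg f (Subsingleton.elim y x)
      simp [this]
    have h0 : ∀ x, f x - ∫ y, f y ∂(Measure.pi μ) = 0 := fun x => sub_eq_zero.2 (this x)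
    simp [mgf, h0]
  | succ n ih =>
    let e := MeasurableEquiv.piFinSuccAbove (fun _ : Fin (n + 1) => α) 0
    have he := (measurePreserving_piFinSuccAbove μ 0).symm
    let ν := Measure.pi fun j : Fin n => μ j.succ
    let G : α → (Fin n → α) → ℝ := fun x z => f (Fin.cons x z)
    have hsymm : ∀ p : α × (Fin n → α), e.symm p = Fin.cons p.1 p.2 := fun p =>
      Fin.insertNth_zero' p.1 p.2
    have hcons : Measurable fun p : α × (Fin n → α) => (Fin.cons p.1 p.2 : Fin (n + 1) → α) := by
      simpa only [← hsymm] using e.symm.measurable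
    have hGm : Measurable fun p : α × (Fin n → α) => G p.1 p.2 := hf.comp hcons
    have hsplit : ∀ F : (Fin (n + 1) → α) → ℝ, Integrable F (Measure.pi μ) →
        ∫ x, F x ∂(Measure.pi μ) = ∫ x, ∫ z, F (Fin.cons x z) ∂ν ∂(μ 0) := by
      intro F hF
      have h1 := he.integral_comp' F
      rw [← h1, integral_prod]
      · exact integral_congr_ae (ae_of_all _ fun x => integral_congr_ae
          (ae_of_all _ fun z => congrArg F (hsymm (x, z))))
      · exact (he.integrable_comp_emb (MeasurableEquiv.measurableEmbedding _)).2 hF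
    have hf_int : Integrable f (Measure.pi μ) := by
      obtain ⟨x₀⟩ := nonempty_of_isProbabilityMeasure (Measure.pi μ)
      refine Integrable.of_bound (C := (n + 1 : ℕ) + |f x₀|) (by fun_prop) (ae_of_all _ fun x => ?_)
      rw [Real.norm_eq_abs]
      linarith [hbound x x₀, abs_sub_abs_le_abs_sub (f x) (f x₀)]
    have hGz : ∀ x, Measurable (G x) := fun x => hGm.comp measurable_prodMk_left
    have hGd : ∀ x z i y, |G x z - G x (Function.update z i y)| ≤ 1 := fun x z i y => by
      simp only [G, Fin.cons_update]
      exact h _ _ _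
    -- `g` averages out all coordinates but the first. In `f - 𝔼f = (f - g) + (g - 𝔼g)`, the
    -- induction hypothesis handles the first term with proxy `n/4`, conditionally on the first
    -- coordinate, and Hoeffding's lemma the second with `1/4`.
    let g : α → ℝ := fun x => ∫ z, G x z ∂ν
    have hgm : Measurable g := (hGm.stronglyMeasurable.integral_prod_right).measurable
    have hG_int : ∀ x, Integrable (G x) ν := by
      intro x
      obtain ⟨z₀⟩ := nonempty_of_isProbabilityMeasure ν
      refine Integrable.of_bound (C := n + |G x z₀|) (hGz x).aestronglyMeasurable
        (ae_of_all _ fun z => ?_)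
      rw [Real.norm_eq_abs]
      linarith [exists_bound_of_bounded_differences (hGd x) z z₀,
        abs_sub_abs_le_abs_sub (G x z) (G x z₀)]
    have hgd : ∀ x y, |g x - g y| ≤ 1 := by
      intro x y
      simp only [g]
      rw [← integral_sub (hG_int x) (hG_int y)]
      have := norm_integral_le_of_norm_le_const (μ := ν) (f := fun z => G x z - G y z) (C := 1)
        (ae_of_all _ fun z => by
          have := h (Fin.cons x z) 0 y
          rwa [Fin.update_cons_zero] at this)
      simpa using this
    have hm : ∫ y, f y ∂(Measure.pi μ) = ∫ x, g x ∂(μ 0) := hsplit f hf_int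
    have hH := (hasSubgaussianMGF_of_abs_sub_le_one (μ := μ 0) hgm hgd)
    rw [hm]
    simp only [mgf] at ih ⊢
    rw [hsplit _ (hintexp _ t)]
    have hinner : ∀ x, ∫ z, Real.exp (t * (f (Fin.cons x z) - ∫ x, g x ∂(μ 0))) ∂ν ≤
        Real.exp (t * (g x - ∫ x, g x ∂(μ 0))) * Real.exp ((n / 4 : NNReal) * t ^ 2 / 2) := by
      intro x
      have hi := ih (fun j : Fin n => μ j.succ) (hGz x) (hGd x)
        (exists_bound_of_bounded_differences (hGd x)) (by
          intro c t
          obtain ⟨z₀⟩ := nonempty_of_isProbabilityMeasure ν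
          refine Integrable.of_bound (C := Real.exp (|t| * (n + |G x z₀ - c|)))
            (by have := hGz x; fun_prop) (ae_of_all _ fun z => ?_)
          rw [Real.norm_eq_abs, Real.abs_exp]
          refine Real.exp_le_exp.2 ((le_abs_self _).trans ?_)
          rw [abs_mul]
          refine mul_le_mul_of_nonneg_left ?_ (abs_nonneg _)
          calc |G x z - c| ≤ |G x z - G x z₀| + |G x z₀ - c| := abs_sub_le _ _ _
            _ ≤ _ := by linarith [exists_bound_of_bounded_differences (hGd x) z z₀])
      refine le_of_eq_of_le ?_ (mul_le_mul_of_nonneg_left hi (Real.exp_pos _).le)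
      rw [← integral_const_mul]
      refine integral_congr_ae (ae_of_all _ fun z => ?_)
      simp only [← Real.exp_add]
      congr 1
      simp only [g, G, ν]
      ring
    have hmgf := hH.mgf_le t
    simp only [mgf] at hmgf
    calc _ ≤ ∫ x, Real.exp (t * (g x - ∫ x, g x ∂(μ 0))) *
          Real.exp ((n / 4 : NNReal) * t ^ 2 / 2) ∂(μ 0) := by
          refine integral_mono_of_nonneg (ae_of_all _ fun x => integral_nonneg fun z =>
            (Real.exp_pos _).le) ((hH.integrable_exp_mul t).mul_const _) (ae_of_all _ hinner)
      _ ≤ Real.exp ((1 / 4 : NNReal) * t ^ 2 / 2) * Real.exp ((n / 4 : NNReal) * t ^ 2 / 2) := by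
          rw [integral_mul_const]
          exact mul_le_mul_of_nonneg_right hmgf (Real.exp_pos _).le
      _ = _ := by
          rw [← Real.exp_add]
          congr 1
          push_cast
          ring

/-- McDiarmid's inequality for independent random variables. -/
theorem iIndepFun.hasSubgaussianMGF_of_bounded_differences {Ω ι : Type*} [MeasurableSpace Ω]
    [MeasurableSpace α]
    [Fintype ι] [DecidableEq ι] {μ : Measure Ω} [IsProbabilityMeasure μ] {X : ι → Ω → α}
    (hX : ∀ i, Measurable (X i)) (hind : iIndepFun X μ) {f : (ι → α) → ℝ} (hf : Measurable f)
    (h : ∀ x i y, |f x - f (Function.update x i y)| ≤ 1) :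
    HasSubgaussianMGF (fun ω => f (fun i => X i ω) - ∫ ω', f (fun i => X i ω') ∂μ)
      (Fintype.card ι / 4) μ := by
  let e := Fintype.equivFin ι
  let X' : Fin (Fintype.card ι) → Ω → α := fun j => X (e.symm j)
  have hind' : iIndepFun X' μ := hind.precomp e.symm.injective
  have hX' : ∀ j, Measurable (X' j) := fun j => hX _
  have hlaw := hind'.map_fun_eq_pi_map fun j => (hX' j).aemeasurable
  have : ∀ j, IsProbabilityMeasure (μ.map (X' j)) := fun j =>
    Measure.isProbabilityMeasure_map (hX' j).aemeasurable
  let f' : (Fin (Fintype.card ι) → α) → ℝ := fun x => f fun i => x (e i)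
  have hf' : Measurable f' := hf.comp (by fun_prop)
  have hsub := hasSubgaussianMGF_pi_of_bounded_differences (fun j => μ.map (X' j)) hf' (by
    intro x i y
    have := h (fun i => x (e i)) (e.symm i) y
    have hu : (fun k => Function.update x i y (e k)) =
        Function.update (fun k => x (e k)) (e.symm i) y := by
      funext k
      simp only [Function.update_apply, Equiv.eq_symm_apply]
    simpa only [f', hu] using this)
  have hXm : Measurable fun ω j => X' j ω := measurable_pi_lambda _ hX'
  rw [← hlaw] at hsub
  have hff : ∀ ω, f' (fun j => X' j ω) = f fun i => X i ω := fun ω => by simp [f', X']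
  have := hsub.of_map hXm.aemeasurable
  simp only [Function.comp_def, hff] at this
  rwa [integral_map hXm.aemeasurable (by fun_prop), integral_congr_ae (ae_of_all _ hff)] at this

end BoundedDifferences

/-! ### Independence of disjoint blocks -/

section Blocks

variable {Ω ι κ 𝒵 : Type*} [MeasurableSpace Ω] [MeasurableSpace 𝒵] {μ : Measure Ω}

/-- Independent random variables, grouped into disjoint blocks, are independent. -/
theorem iIndepFun.blocks [IsProbabilityMeasure μ] {ξ : ι → Ω → 𝒵} (hξ : ∀ i, Measurable (ξ i))
    (hind : iIndepFun ξ μ) {b : κ → Finset ι} (hb : Pairwise fun k l => Disjoint (b k) (b l)) :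
    iIndepFun (fun (k : κ) ω (i : b k) => ξ i ω) μ := by
  let g : ((k : κ) × b k) → ι := fun p => p.2
  have hg : g.Injective := by
    rintro ⟨k, i⟩ ⟨l, j⟩ (hij : (i : ι) = j)
    obtain rfl : k = l := by
      by_contra hkl
      exact Finset.disjoint_left.1 (hb hkl) i.2 (hij ▸ j.2)
    rw [Subtype.ext hij]
  have h1 := hind.precomp hg
  have hm : ∀ p, Measurable ((ξ ∘ g) p) := fun p => hξ _
  have hprob : ∀ (k : κ) (i : b k), IsProbabilityMeasure (μ.map (ξ i)) := fun k i =>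
    Measure.isProbabilityMeasure_map (hξ i).aemeasurable
  rw [iIndepFun_iff_map_fun_eq_infinitePi_map (by fun_prop)]
  have h2 := (iIndepFun_iff_map_fun_eq_infinitePi_map hm).1 h1
  have h3 : ∀ k, μ.map (fun ω (i : b k) => ξ i ω) =
      Measure.infinitePi fun i : b k => μ.map (ξ i) := fun k =>
    (iIndepFun_iff_map_fun_eq_infinitePi_map (X := fun i : b k => ξ i) (fun i => hξ i)).1
      (hind.precomp (g := fun i : b k => (i : ι)) Subtype.val_injective)
  simp only [h3]
  have h4 : (MeasurableEquiv.piCurry fun (k : κ) (_ : b k) => 𝒵) ∘ (fun ω p => (ξ ∘ g) p ω) =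
      fun ω (k : κ) (i : b k) => ξ i ω := by
    ext; simp [Sigma.curry, g]
  rw [← h4, ← Measure.map_map (by fun_prop) (by fun_prop), h2]
  exact Measure.infinitePi_map_piCurry (fun k (i : b k) => μ.map (ξ i))

end Blocks

/-! ### A Lipschitz majorant of the indicator of large deviations -/

section Ramp

/-- A Lipschitz function of `x` that is `0` for `|x| ≤ s / 2` and `1` for `|x| ≥ s`. -/
noncomputable def ramp (s x : ℝ) : ℝ := max 0 (min 1 (2 * |x| / s - 1))

lemma ramp_nonneg (s x : ℝ) : 0 ≤ ramp s x := le_max_left _ _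

lemma ramp_le_one (s x : ℝ) : ramp s x ≤ 1 := max_le zero_le_one (min_le_left _ _)

lemma continuous_ramp (s : ℝ) : Continuous (ramp s) := by
  unfold ramp
  fun_prop

lemma ramp_eq_one {s x : ℝ} (hs : 0 < s) (h : s ≤ |x|) : ramp s x = 1 := by
  have : 1 ≤ |x| / s := (one_le_div hs).2 h
  rw [ramp, min_eq_left (by rw [mul_div_assoc]; linarith), max_eq_right zero_le_one]

/-- With `u = |x| / s` this is `2u - 1 ≤ u²`. It bounds the mean of a ramp by a second moment, as in
Chebyshev's inequality. -/
lemma ramp_le_sq {s : ℝ} (x : ℝ) : ramp s x ≤ x ^ 2 / s ^ 2 := by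
  have : x ^ 2 / s ^ 2 = (|x| / s) ^ 2 := by rw [div_pow, sq_abs]
  rw [this]
  refine max_le (by positivity) ((min_le_right _ _).trans ?_)
  rw [mul_div_assoc]
  nlinarith [sq_nonneg (|x| / s - 1)]

lemma abs_ramp_sub_le {s : ℝ} (x y : ℝ) :
    |ramp s x - ramp s y| ≤ |2 / s * x - 2 / s * y| := by
  have h1 : |ramp s x - ramp s y| ≤ |(2 * |x| / s - 1) - (2 * |y| / s - 1)| := by
    refine (abs_max_sub_max_le_max _ _ _ _).trans (max_le (by simp) ?_)
    refine (abs_min_sub_min_le_max _ _ _ _).trans (max_le (by simp) le_rfl)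
  refine h1.trans ?_
  have e1 : (2 * |x| / s - 1) - (2 * |y| / s - 1) = 2 / s * (|x| - |y|) := by ring
  rw [e1, ← mul_sub, abs_mul, abs_mul]
  exact mul_le_mul_of_nonneg_left (abs_abs_sub_abs_le_abs_sub x y) (abs_nonneg _)

end Ramp

/-! ### Uniform deviations of block means over a finite class -/

section Deviation

variable {Ω ι κ T 𝒵 : Type*} [MeasurableSpace Ω] {μ : Measure Ω} [IsProbabilityMeasure μ]

/-- The mean over a block of size `q` of the values of `h`, minus `m`. -/
noncomputable def centeredMean (ξ : ι → Ω → 𝒵) (b : κ → Finset ι) (q : ℕ) (h : 𝒵 → ℝ) (m : ℝ)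
    (k : κ) (ω : Ω) : ℝ :=
  (∑ i ∈ b k, h (ξ i ω)) / q - m

lemma integrable_centeredMean {ξ : ι → Ω → 𝒵} {b : κ → Finset ι} {q : ℕ} {h : 𝒵 → ℝ} {m : ℝ}
    (hi : ∀ i, Integrable (fun ω => h (ξ i ω)) μ) (k : κ) :
    Integrable (fun ω => centeredMean ξ b q h m k ω) μ :=
  ((integrable_finsetSum _ fun i _ => hi i).div_const _).sub (integrable_const _)

variable [MeasurableSpace 𝒵]

lemma iIndepFun_centeredMean {ξ : ι → Ω → 𝒵} (hξ : ∀ i, Measurable (ξ i)) (hind : iIndepFun ξ μ)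
    {b : κ → Finset ι} (hb : Pairwise fun k l => Disjoint (b k) (b l)) (q : ℕ)
    {h : T → 𝒵 → ℝ} (hh : ∀ t, Measurable (h t)) (m : T → ℝ) :
    iIndepFun (fun k ω t => centeredMean ξ b q (h t) (m t) k ω) μ := by
  have := (iIndepFun.blocks hξ hind hb).comp
    (fun k (x : b k → 𝒵) (t : T) => (∑ i : b k, h t (x i)) / q - m t)
    (fun k => measurable_pi_lambda _ fun t => by
      have := hh t
      fun_prop)
  convert this using 4 with k ω t
  simp only [centeredMean, Function.comp]
  rw [Finset.sum_coe_sort (b k) (fun i => h t (ξ i ω))]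

/-- The variance of a mean of `q` independent terms with common mean `m`; each variance is bounded
by the second moment. -/
lemma integral_sq_centeredMean_le {ξ : ι → Ω → 𝒵} (hind : iIndepFun ξ μ)
    {b : κ → Finset ι} {q : ℕ} (hq : 0 < q) (hbq : ∀ k, (b k).card = q)
    {h : 𝒵 → ℝ} (hh : Measurable h) {m v : ℝ}
    (hL2 : ∀ i, MemLp (fun ω => h (ξ i ω)) 2 μ) (hm : ∀ i, ∫ ω, h (ξ i ω) ∂μ = m)
    (hv : ∀ i, ∫ ω, h (ξ i ω) ^ 2 ∂μ ≤ v) (k : κ) :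
    ∫ ω, centeredMean ξ b q h m k ω ^ 2 ∂μ ≤ v / q := by
  have hq' : (0 : ℝ) < q := by exact_mod_cast hq
  have hsum : MemLp (fun ω => ∑ i ∈ b k, h (ξ i ω)) 2 μ := memLp_finsetSum _ fun i _ => hL2 i
  have hmean : ∫ ω, ∑ i ∈ b k, h (ξ i ω) ∂μ = q * m := by
    rw [integral_finsetSum _ fun i _ => (hL2 i).integrable one_le_two]
    simp [hm, hbq]
  have hvar : variance (fun ω => ∑ i ∈ b k, h (ξ i ω)) μ ≤ q * v := by
    have h1 := IndepFun.variance_sum (μ := μ) (X := fun i ω => h (ξ i ω)) (s := b k)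
      (fun i _ => hL2 i) fun i _ j _ hij => (hind.indepFun hij).comp hh hh
    have h2 : (∑ i ∈ b k, fun ω => h (ξ i ω)) = fun ω => ∑ i ∈ b k, h (ξ i ω) := by
      ext ω; simp
    rw [h2] at h1
    rw [h1, ← hbq k, ← nsmul_eq_mul]
    refine Finset.sum_le_card_nsmul _ _ _ fun i _ => ?_
    exact (variance_le_expectation_sq (hL2 i).aestronglyMeasurable).trans (hv i)
  rw [variance_eq_integral hsum.aemeasurable, hmean] at hvar
  have e : ∀ ω, centeredMean ξ b q h m k ω ^ 2 =
      1 / (q : ℝ) ^ 2 * (∑ i ∈ b k, h (ξ i ω) - q * m) ^ 2 := fun ω => by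
    rw [centeredMean]
    field_simp
  simp only [e]
  rw [integral_const_mul]
  calc _ ≤ 1 / (q : ℝ) ^ 2 * (q * v) := by gcongr
    _ = v / q := by field_simp

lemma measurable_centeredMean {ξ : ι → Ω → 𝒵} (hξ : ∀ i, Measurable (ξ i)) {b : κ → Finset ι}
    {q : ℕ} {h : 𝒵 → ℝ} (hh : Measurable h) {m : ℝ} (k : κ) :
    Measurable fun ω => centeredMean ξ b q h m k ω :=
  ((Finset.measurable_sum _ fun i _ => hh.comp (hξ i)).div_const _).sub_const _

lemma integrable_ramp {s : ℝ} {X : Ω → ℝ} (hX : AEMeasurable X μ) :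
    Integrable (fun ω => ramp s (X ω)) μ :=
  Integrable.of_bound (C := 1)
    ((continuous_ramp s).measurable.comp_aemeasurable hX).aestronglyMeasurable
    (ae_of_all _ fun ω => by
      rw [Real.norm_eq_abs, abs_of_nonneg (ramp_nonneg _ _)]
      exact ramp_le_one _ _)

/-- Two symmetrizations and two contractions bound the expected maximal deviation of a sum over
blocks of truncated means by a Rademacher average over the sample. -/
theorem integral_iSup_sum_ramp_le [Fintype ι] [DecidableEq ι] [Fintype κ] [DecidableEq κ]
    [Finite T] [Nonempty T]
    {ξ : ι → Ω → 𝒵} (hξ : ∀ i, Measurable (ξ i))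
    (hind : iIndepFun ξ μ) {b : κ → Finset ι} (hb : Pairwise fun k l => Disjoint (b k) (b l))
    {q : ℕ} (hbq : ∀ k, (b k).card = q) (hq : 0 < q) {h d : T → 𝒵 → ℝ}
    (hh : ∀ t, Measurable (h t)) {m : T → ℝ} (hhi : ∀ t i, Integrable (fun ω => h t (ξ i ω)) μ)
    (hdi : ∀ t i, Integrable (fun ω => d t (ξ i ω)) μ)
    (hm : ∀ t i, ∫ ω, h t (ξ i ω) ∂μ = m t) {L s R : ℝ} (hL : 0 ≤ L) (hs : 0 < s)
    (hhd : ∀ z t u, |h t z - h u z| ≤ L * |d t z - d u z|) {J : Finset ι} (hJ : ∀ k, b k ⊆ J)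
    (hR : ∑ ε : ι → ℤˣ, ∫ ω, ⨆ t, ∑ i ∈ J, ((ε i : ℤ) : ℝ) * d t (ξ i ω) ∂μ ≤
      2 ^ Fintype.card ι * R) :
    ∫ ω, ⨆ t, ∑ k, (ramp s (centeredMean ξ b q (h t) (m t) k ω) -
      ∫ ω', ramp s (centeredMean ξ b q (h t) (m t) k ω') ∂μ) ∂μ ≤ 8 * L / (s * q) * R := by
  have hq' : (0 : ℝ) < q := by exact_mod_cast hq
  let V : κ → Ω → T → ℝ := fun k ω t => centeredMean ξ b q (h t) (m t) k ω
  have hVm : ∀ k, Measurable (V k) := fun k =>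
    measurable_pi_lambda _ fun t => measurable_centeredMean hξ (hh t) k
  have hVi : ∀ k t, Integrable (fun ω => V k ω t) μ := fun k t =>
    integrable_centeredMean (hhi t) k
  have hV : iIndepFun V μ := iIndepFun_centeredMean hξ hind hb q hh m
  have hrm : Measurable fun (x : T → ℝ) t => ramp s (x t) := by
    have := (continuous_ramp s).measurable
    fun_prop
  have hri : ∀ k t, Integrable (fun ω => ramp s (V k ω t)) μ := fun k t =>
    integrable_ramp (hVi k t).aemeasurable
  -- symmetrization over the blocks
  have h1 := integral_iSup_sum_centered_le (μ := μ) (X := fun k ω t => ramp s (V k ω t))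
    (fun k => hrm.comp (hVm k)) hri (hV.comp (fun _ x t => ramp s (x t)) fun _ => hrm)
  -- contraction of the truncation
  have h2 : ∑ σ : κ → ℤˣ, ∫ ω, ⨆ t, ∑ k, ((σ k : ℤ) : ℝ) * (2 * ramp s (V k ω t)) ∂μ ≤
      ∑ σ : κ → ℤˣ, ∫ ω, ⨆ t, ∑ k, ((σ k : ℤ) : ℝ) * (4 / s * V k ω t) ∂μ := by
    have i1 : ∀ σ : κ → ℤˣ,
        Integrable (fun ω => ⨆ t, ∑ k, ((σ k : ℤ) : ℝ) * (2 * ramp s (V k ω t))) μ := fun σ =>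
      Integrable.iSup_finite fun t => integrable_finsetSum _ fun k _ =>
        ((hri k t).const_mul _).const_mul _
    have i2 : ∀ σ : κ → ℤˣ,
        Integrable (fun ω => ⨆ t, ∑ k, ((σ k : ℤ) : ℝ) * (4 / s * V k ω t)) μ := fun σ =>
      Integrable.iSup_finite fun t => integrable_finsetSum _ fun k _ =>
        ((hVi k t).const_mul _).const_mul _
    rw [← integral_finsetSum _ fun σ _ => i1 σ, ← integral_finsetSum _ fun σ _ => i2 σ]
    refine integral_mono (integrable_finsetSum _ fun σ _ => i1 σ)
      (integrable_finsetSum _ fun σ _ => i2 σ) fun ω => ?_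
    refine sum_signs_iSup_le fun k t u => ?_
    have := abs_ramp_sub_le (s := s) (V k ω t) (V k ω u)
    rw [← mul_sub, ← mul_sub, abs_mul] at *
    rw [abs_mul]
    -- The `2` is the symmetrization factor and `2 / s` the Lipschitz constant of `ramp s`.
    have e : |4 / s| = 2 * |2 / s| := by
      rw [abs_of_pos (by positivity), abs_of_pos (by positivity)]; ring
    rw [e, abs_two]
    nlinarith
  -- symmetrization and contraction over the sample
  have h3 : ∀ σ : κ → ℤˣ, ∫ ω, ⨆ t, ∑ k, ((σ k : ℤ) : ℝ) * (4 / s * V k ω t) ∂μ ≤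
      8 * L / (s * q) * R := by
    intro σ
    -- With the block signs frozen, the sum over blocks is a weighted sum over data points; by
    -- disjointness a point has the weight of its only block, or `0`.
    let c : ι → ℝ := fun i => ∑ k, if i ∈ b k then ((σ k : ℤ) : ℝ) * (4 / (s * q)) else 0
    have hc : ∀ i, |c i| ≤ if i ∈ J then 4 / (s * q) else 0 := by
      intro i
      by_cases hi : ∃ k, i ∈ b k
      · obtain ⟨k, hk⟩ := hi
        have : c i = ((σ k : ℤ) : ℝ) * (4 / (s * q)) := by
          refine (Finset.sum_eq_single k (fun l _ hl => if_neg fun hil => ?_)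
            (by simp)).trans (if_pos hk)
          exact Finset.disjoint_left.1 (hb hl) hil hk
        rw [if_pos (hJ k hk), this, abs_mul, abs_of_pos (a := 4 / (s * q)) (by positivity)]
        rcases Int.units_eq_one_or (σ k) with h | h <;> simp [h]
      · have : c i = 0 := Finset.sum_eq_zero fun k _ => if_neg fun hk => hi ⟨k, hk⟩
        rw [this, abs_zero]
        split_ifs <;> positivity
    have hcsum : ∀ y : ι → ℝ, ∑ i, c i * y i =
        ∑ k, ((σ k : ℤ) : ℝ) * (4 / s * ((∑ i ∈ b k, y i) / q)) := by
      intro y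
      simp only [c, Finset.sum_mul]
      rw [Finset.sum_comm]
      refine Finset.sum_congr rfl fun k _ => ?_
      simp only [ite_mul, zero_mul]
      rw [← Finset.sum_filter, Finset.filter_mem_eq_inter, Finset.univ_inter, ← Finset.mul_sum]
      field_simp
    have hexp : ∀ ω t, ∑ k, ((σ k : ℤ) : ℝ) * (4 / s * V k ω t) =
        ∑ i, (c i * h t (ξ i ω) - ∫ ω', c i * h t (ξ i ω') ∂μ) := by
      intro ω t
      simp only [integral_const_mul, hm, ← mul_sub]
      rw [hcsum]
      refine Finset.sum_congr rfl fun k _ => ?_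
      simp only [V, centeredMean, Finset.sum_sub_distrib, Finset.sum_const, hbq, nsmul_eq_mul]
      field_simp
    simp only [hexp]
    have hYm : ∀ i, Measurable fun (z : 𝒵) t => c i * h t z := fun i =>
      measurable_pi_lambda _ fun t => (hh t).const_mul _
    have h4 := integral_iSup_sum_centered_le (μ := μ) (X := fun i ω t => c i * h t (ξ i ω))
      (fun i => (hYm i).comp (hξ i)) (fun i t => (hhi t i).const_mul _)
      (hind.comp (fun i z t => c i * h t z) hYm)
    have h5 : ∑ ε : ι → ℤˣ, ∫ ω, ⨆ t, ∑ i, ((ε i : ℤ) : ℝ) * (2 * (c i * h t (ξ i ω))) ∂μ ≤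
        ∑ ε : ι → ℤˣ, ∫ ω, ⨆ t, ∑ i, ((ε i : ℤ) : ℝ) *
          (8 * L / (s * q) * if i ∈ J then d t (ξ i ω) else 0) ∂μ := by
      have i1 : ∀ ε : ι → ℤˣ, Integrable
          (fun ω => ⨆ t, ∑ i, ((ε i : ℤ) : ℝ) * (2 * (c i * h t (ξ i ω)))) μ := fun ε =>
        Integrable.iSup_finite fun t => integrable_finsetSum _ fun i _ =>
          (((hhi t i).const_mul _).const_mul _).const_mul _
      have i2 : ∀ ε : ι → ℤˣ, Integrable (fun ω => ⨆ t, ∑ i, ((ε i : ℤ) : ℝ) *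
          (8 * L / (s * q) * if i ∈ J then d t (ξ i ω) else 0)) μ := fun ε =>
        Integrable.iSup_finite fun t => integrable_finsetSum _ fun i _ => by
          by_cases hi : i ∈ J
          · simpa only [hi, if_true] using ((hdi t i).const_mul _).const_mul _
          · simp [hi]
      rw [← integral_finsetSum _ fun σ _ => i1 σ, ← integral_finsetSum _ fun σ _ => i2 σ]
      refine integral_mono (integrable_finsetSum _ fun σ _ => i1 σ)
        (integrable_finsetSum _ fun σ _ => i2 σ) fun ω => ?_
      -- This contraction removes both the loss and the weights. Points of `J` outside all blocks
      -- have weight `0`, and contraction allows raising it to the common bound, so `J` may be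
      -- larger than the union of the blocks.
      refine sum_signs_iSup_le fun i t u => ?_
      rw [← mul_sub, ← mul_sub, ← mul_sub, abs_mul, abs_mul, abs_mul, abs_two]
      have hci := hc i
      by_cases hi : i ∈ J
      · rw [if_pos hi] at hci
        rw [if_pos hi, if_pos hi, abs_of_nonneg (a := 8 * L / (s * q)) (by positivity)]
        calc 2 * (|c i| * |h t (ξ i ω) - h u (ξ i ω)|)
            ≤ 2 * (4 / (s * q) * (L * |d t (ξ i ω) - d u (ξ i ω)|)) := by
              have := hhd (ξ i ω) t u
              gcongr
          _ = _ := by ring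
      · rw [if_neg hi] at hci
        have : |c i| = 0 := le_antisymm hci (abs_nonneg _)
        rw [this]
        simp [hi]
    have h6 : ∑ ε : ι → ℤˣ, ∫ ω, ⨆ t, ∑ i, ((ε i : ℤ) : ℝ) *
          (8 * L / (s * q) * if i ∈ J then d t (ξ i ω) else 0) ∂μ =
        8 * L / (s * q) *
          ∑ ε : ι → ℤˣ, ∫ ω, ⨆ t, ∑ i ∈ J, ((ε i : ℤ) : ℝ) * d t (ξ i ω) ∂μ := by
      rw [Finset.mul_sum]
      refine Finset.sum_congr rfl fun ε _ => ?_
      rw [← integral_const_mul]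
      refine integral_congr_ae (ae_of_all _ fun ω => ?_)
      simp only []
      rw [Real.mul_iSup_of_nonneg (by positivity)]
      refine iSup_congr fun t => ?_
      rw [Finset.mul_sum, ← Finset.sum_subset (Finset.subset_univ J)
        (fun i _ hi => by simp [hi])]
      refine Finset.sum_congr rfl fun i hi => ?_
      rw [if_pos hi]
      ring
    have h7 := h4.trans (h5.trans (h6.le.trans (mul_le_mul_of_nonneg_left hR (by positivity))))
    have h2pos : (0 : ℝ) < 2 ^ Fintype.card ι := by positivity
    refine le_of_mul_le_mul_left (h7.trans (le_of_eq ?_)) h2pos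
    ring
  have h8 := h1.trans (h2.trans (Finset.sum_le_sum fun σ _ => h3 σ))
  rw [Finset.sum_const, Finset.card_univ, Fintype.card_fun, Fintype.card_units_int,
    nsmul_eq_mul] at h8
  push_cast at h8
  exact le_of_mul_le_mul_left h8 (by positivity)

/-- Concentration of the number of blocks with a large deviation, uniformly over a finite class. -/
theorem measureReal_exists_sum_ramp_gt_le [Fintype ι] [DecidableEq ι] [Fintype κ]
    [Finite T] [Nonempty T]
    {ξ : ι → Ω → 𝒵} (hξ : ∀ i, Measurable (ξ i))
    (hind : iIndepFun ξ μ) {b : κ → Finset ι} (hb : Pairwise fun k l => Disjoint (b k) (b l))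
    {q : ℕ} (hbq : ∀ k, (b k).card = q) (hq : 0 < q) {h d : T → 𝒵 → ℝ}
    (hh : ∀ t, Measurable (h t)) {m : T → ℝ} (hhL2 : ∀ t i, MemLp (fun ω => h t (ξ i ω)) 2 μ)
    (hdi : ∀ t i, Integrable (fun ω => d t (ξ i ω)) μ)
    (hm : ∀ t i, ∫ ω, h t (ξ i ω) ∂μ = m t) {v : ℝ}
    (hv : ∀ t i, ∫ ω, h t (ξ i ω) ^ 2 ∂μ ≤ v) {L s R : ℝ} (hL : 0 ≤ L) (hs : 0 < s)
    (hhd : ∀ z t u, |h t z - h u z| ≤ L * |d t z - d u z|) {J : Finset ι} (hJ : ∀ k, b k ⊆ J)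
    (hR : ∑ ε : ι → ℤˣ, ∫ ω, ⨆ t, ∑ i ∈ J, ((ε i : ℤ) : ℝ) * d t (ξ i ω) ∂μ ≤
      2 ^ Fintype.card ι * R) {δ : ℝ} (hδ : 0 ≤ δ) [Nonempty κ] :
    μ.real {ω | ∃ t, Fintype.card κ * (v / (q * s ^ 2) + δ) + 8 * L / (s * q) * R <
      ∑ k, ramp s (centeredMean ξ b q (h t) (m t) k ω)} ≤
      Real.exp (-(2 * Fintype.card κ * δ ^ 2)) := by
  classical
  let e : κ → T → ℝ := fun k t => ∫ ω', ramp s (centeredMean ξ b q (h t) (m t) k ω') ∂μ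
  let V : κ → Ω → T → ℝ := fun k ω t => centeredMean ξ b q (h t) (m t) k ω
  let f : (κ → T → ℝ) → ℝ := fun x => ⨆ t, ∑ k, (ramp s (x k t) - e k t)
  have hVm : ∀ k, Measurable (V k) := fun k =>
    measurable_pi_lambda _ fun t => measurable_centeredMean hξ (hh t) k
  have hV : iIndepFun V μ := iIndepFun_centeredMean hξ hind hb q hh m
  have hf : Measurable f := by
    have := (continuous_ramp s).measurable
    exact Measurable.iSup fun t => by fun_prop
  -- Ramps take values in `[0, 1]`, so changing one block moves the supremum by at most `1`.
  have hfd : ∀ x k y, f x ≤ f (Function.update x k y) + 1 := by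
    intro x k y
    refine ciSup_le fun t => ?_
    have h1 := le_ciSup (f := fun t => ∑ l, (ramp s (Function.update x k y l t) - e l t))
      (Set.finite_range _).bddAbove t
    refine le_trans ?_ (add_le_add_left h1 1)
    rw [← Finset.sum_erase_add _ _ (Finset.mem_univ k),
      ← Finset.sum_erase_add _ _ (Finset.mem_univ k)]
    have h2 : ∑ l ∈ Finset.univ.erase k, (ramp s (Function.update x k y l t) - e l t) =
        ∑ l ∈ Finset.univ.erase k, (ramp s (x l t) - e l t) :=
      Finset.sum_congr rfl fun l hl => by
        rw [Function.update_of_ne (Finset.ne_of_mem_erase hl)]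
    rw [h2, Function.update_self]
    linarith [ramp_nonneg s (y t), ramp_le_one s (x k t)]
  have hsub := iIndepFun.hasSubgaussianMGF_of_bounded_differences hVm hV hf (by
    intro x k y
    have h1 := hfd x k y
    have h2 := hfd (Function.update x k y) k (x k)
    rw [Function.update_idem, Function.update_eq_self] at h2
    rw [abs_le]
    constructor <;> linarith)
  have hκ : (0 : ℝ) < Fintype.card κ := by exact_mod_cast Fintype.card_pos
  have hconc := hsub.measure_ge_le (ε := Fintype.card κ * δ) (by positivity)
  have hmean := integral_iSup_sum_ramp_le hξ hind hb hbq hq hh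
    (fun t i => (hhL2 t i).integrable one_le_two) hdi hm hL hs hhd hJ hR
  have he : ∀ k t, e k t ≤ v / (q * s ^ 2) := by
    intro k t
    have h1 : MemLp (fun ω => centeredMean ξ b q (h t) (m t) k ω) 2 μ := by
      have h2 : MemLp (fun ω => ∑ i ∈ b k, h t (ξ i ω)) 2 μ :=
        memLp_finsetSum _ fun i _ => hhL2 t i
      have h3 := (h2.const_mul (1 / (q : ℝ))).sub (memLp_const (m t))
      refine h3.ae_eq (ae_of_all _ fun ω => ?_)
      simp only [centeredMean, Pi.sub_apply]
      ring
    calc e k t ≤ ∫ ω, centeredMean ξ b q (h t) (m t) k ω ^ 2 / s ^ 2 ∂μ :=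
          integral_mono (integrable_ramp h1.aemeasurable) (h1.integrable_sq.div_const _)
            fun ω => ramp_le_sq _
      _ ≤ (v / q) / s ^ 2 := by
          rw [integral_div]
          have := integral_sq_centeredMean_le hind hq hbq (hh t) (hhL2 t) (hm t) (hv t) k
          gcongr
      _ = _ := by rw [div_div]
  refine (measureReal_mono ?_).trans (hconc.trans (le_of_eq ?_))
  · rintro ω ⟨t, ht⟩
    have h1 := le_ciSup (f := fun t => ∑ k, (ramp s (V k ω t) - e k t))
      (Set.finite_range _).bddAbove t
    have h2 : ∑ k, e k t ≤ Fintype.card κ * (v / (q * s ^ 2)) := by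
      rw [← nsmul_eq_mul, ← Finset.card_univ]
      exact Finset.sum_le_card_nsmul _ _ _ fun k _ => he k t
    simp only [Finset.sum_sub_distrib] at h1
    have h3 : ∑ k, ramp s (V k ω t) - ∑ k, e k t ≤ f fun k => V k ω := by
      simpa only [f, Finset.sum_sub_distrib] using h1
    have h4 : ∫ ω', f (fun k => V k ω') ∂μ ≤ 8 * L / (s * q) * R := hmean
    simp only [Set.mem_ofPred_eq]
    have h5 : ∑ k, ramp s (V k ω t) = ∑ k, ramp s (centeredMean ξ b q (h t) (m t) k ω) := rfl
    linarith
  -- The tail exponent: `(nδ)² / (2 · n/4) = 2nδ²` for `n` blocks.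
  · congr 1
    push_cast
    field_simp
    ring

end Deviation

/-! ### Majorities and the median -/

section Median

variable {K : ℕ} {a : Fin K → ℝ} {s : ℝ}

lemma exists_mem_filter_of_le_two_mul_card (hK : 0 < K) {p : Fin K → Prop} [DecidablePred p]
    (h : K ≤ 2 * (Finset.univ.filter p).card) : ∃ k, p k := by
  have : 0 < (Finset.univ.filter p).card := by omega
  obtain ⟨k, hk⟩ := Finset.card_pos.1 this
  exact ⟨k, (Finset.mem_filter.1 hk).2⟩

lemma card_filter_add_card_filter_le {p r : Fin K → Prop} [DecidablePred p] [DecidablePred r]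
    (h : ∀ k, p k → ¬ r k) :
    (Finset.univ.filter p).card + (Finset.univ.filter r).card ≤ K := by
  rw [← Finset.card_union_of_disjoint (Finset.disjoint_filter.2 fun k _ => h k)]
  simpa using Finset.card_le_univ (Finset.univ.filter p ∪ Finset.univ.filter r)

lemma pos_of_lt_two_mul_card {p : Fin K → Prop} [DecidablePred p]
    (h : K < 2 * (Finset.univ.filter p).card) : 0 < K := by
  have := Finset.card_le_univ (Finset.univ.filter p)
  rw [Fintype.card_fin] at this
  omega

lemma le_sum_abs (a : Fin K → ℝ) (k : Fin K) : |a k| ≤ ∑ l, |a l| :=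
  Finset.single_le_sum (f := fun l => |a l|) (fun _ _ => abs_nonneg _) (Finset.mem_univ k)

/-- A strict majority forces both endpoints of the interval of medians above `s`: half of the blocks
would not control the left endpoint. It also excludes `K = 0`, where both defining sets are all of
`ℝ` and `sInf`, `sSup` take default values. -/
lemma le_median (h : K < 2 * (Finset.univ.filter fun k => s ≤ a k).card) : s ≤ median a := by
  have hK := pos_of_lt_two_mul_card h
  have h1 : s ≤ sInf {t : ℝ | K ≤ 2 * (Finset.univ.filter fun k => a k ≤ t).card} := by
    refine le_csInf ⟨∑ l, |a l|, ?_⟩ fun t ht => ?_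
    · have : (Finset.univ.filter fun k => a k ≤ ∑ l, |a l|) = Finset.univ :=
        Finset.filter_true_of_mem fun k _ => (le_abs_self _).trans (le_sum_abs a k)
      simp only [Set.mem_ofPred_eq, this, Finset.card_univ, Fintype.card_fin]
      omega
    · by_contra! hts
      have := card_filter_add_card_filter_le (p := fun k => s ≤ a k) (r := fun k => a k ≤ t)
        fun k h1 h2 => by linarith
      simp only [Set.mem_ofPred_eq] at ht
      omega
  have h2 : s ≤ sSup {t : ℝ | K ≤ 2 * (Finset.univ.filter fun k => t ≤ a k).card} := by
    refine le_csSup ⟨∑ l, |a l|, fun t ht => ?_⟩ h.le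
    obtain ⟨k, hk⟩ := exists_mem_filter_of_le_two_mul_card hK ht
    exact hk.trans ((le_abs_self _).trans (le_sum_abs a k))
  rw [median]
  linarith

lemma median_le (h : K < 2 * (Finset.univ.filter fun k => a k ≤ s).card) : median a ≤ s := by
  have hK := pos_of_lt_two_mul_card h
  have h1 : sSup {t : ℝ | K ≤ 2 * (Finset.univ.filter fun k => t ≤ a k).card} ≤ s := by
    refine csSup_le ⟨-∑ l, |a l|, ?_⟩ fun t ht => ?_
    · have : (Finset.univ.filter fun k => -∑ l, |a l| ≤ a k) = Finset.univ :=
        Finset.filter_true_of_mem fun k _ =>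
          (neg_le_neg (le_sum_abs a k)).trans (neg_abs_le _)
      simp only [Set.mem_ofPred_eq, this, Finset.card_univ, Fintype.card_fin]
      omega
    · by_contra! hts
      have := card_filter_add_card_filter_le (p := fun k => a k ≤ s) (r := fun k => t ≤ a k)
        fun k h1 h2 => by linarith
      simp only [Set.mem_ofPred_eq] at ht
      omega
  have h2 : sInf {t : ℝ | K ≤ 2 * (Finset.univ.filter fun k => a k ≤ t).card} ≤ s := by
    refine csInf_le ⟨-∑ l, |a l|, fun t ht => ?_⟩ h.le
    obtain ⟨k, hk⟩ := exists_mem_filter_of_le_two_mul_card hK ht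
    exact ((neg_le_neg (le_sum_abs a k)).trans (neg_abs_le _)).trans hk
  rw [median]
  linarith

end Median

/-! ### Excess losses: convexity, measurability, L₂ bounds -/

section Loss

variable {𝒳 𝒴 : Type*} {Ybar : Set ℝ} {ℓ : ℝ → 𝒴 → ℝ} {L : ℝ} {f g fs : 𝒳 → ℝ}

/-- The mean of `h` over the `k`-th block. -/
noncomputable def blockMean {𝒵 : Type*} {N K : ℕ} (B : Fin K → Finset (Fin N)) (z : Fin N → 𝒵)
    (h : 𝒵 → ℝ) (k : Fin K) : ℝ :=
  (∑ i ∈ B k, h (z i)) / (B k).card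

lemma card_lt_of_imp {K : ℕ} {p r : Fin K → Prop} [DecidablePred p] [DecidablePred r]
    (h : K < 2 * (Finset.univ.filter p).card) (hpr : ∀ k, p k → r k) :
    K < 2 * (Finset.univ.filter r).card := by
  have := Finset.card_le_card (Finset.monotone_filter_right Finset.univ fun k _ => hpr k)
  omega

lemma blockMean_lossDiff_neg {N K : ℕ} {B : Fin K → Finset (Fin N)} {z : Fin N → 𝒳 × 𝒴}
    (f : 𝒳 → ℝ) (k : Fin K) :
    blockMean B z (lossDiff ℓ fs f) k = -blockMean B z (lossDiff ℓ f fs) k := by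
  rw [blockMean, blockMean, ← neg_div, ← Finset.sum_neg_distrib]
  simp [lossDiff]

lemma segment_mem {F : Set (𝒳 → ℝ)} (hF : Convex ℝ F) (hfs : fs ∈ F) (hf : f ∈ F) {c : ℝ}
    (hc0 : 0 ≤ c) (hc1 : c ≤ 1) : fs + c • (f - fs) ∈ F :=
  hF.add_smul_sub_mem hfs hf ⟨hc0, hc1⟩

variable [MeasurableSpace 𝒴]

lemma abs_lossDiff_le (hloss : IsLipschitzConvexLoss Ybar ℓ L) (hf : ∀ x, f x ∈ Ybar)
    (hg : ∀ x, g x ∈ Ybar) (z : 𝒳 × 𝒴) : |lossDiff ℓ f g z| ≤ L * |f z.1 - g z.1| :=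
  hloss.lipschitz _ _ (hf _) _ (hg _)

/-- Convexity of the loss, pointwise in the data; being pointwise, it survives averaging over any
block, even one containing outliers. -/
lemma lossDiff_segment_le (hloss : IsLipschitzConvexLoss Ybar ℓ L) (hfY : ∀ x, f x ∈ Ybar)
    (hfsY : ∀ x, fs x ∈ Ybar) {c : ℝ} (hc0 : 0 ≤ c) (hc1 : c ≤ 1) (z : 𝒳 × 𝒴) :
    lossDiff ℓ (fs + c • (f - fs)) fs z ≤ c * lossDiff ℓ f fs z := by
  have := (hloss.convex z.2).2 (hfY z.1) (hfsY z.1) hc0 (sub_nonneg.2 hc1) (by ring)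
  have e : c • f z.1 + (1 - c) • fs z.1 = (fs + c • (f - fs)) z.1 := by
    simp only [smul_eq_mul, Pi.add_apply, Pi.smul_apply, Pi.sub_apply]; ring
  simp only [e] at this
  simp only [lossDiff, smul_eq_mul] at *
  linarith

variable [MeasurableSpace 𝒳] {Q : Measure (𝒳 × 𝒴)}

/-- The loss is a Carathéodory function on `Ybar × 𝒴` (continuous in the prediction, measurable in
`y`), hence jointly measurable. -/
lemma measurable_lossDiff (hloss : IsLipschitzConvexLoss Ybar ℓ L) (hf : Measurable f)
    (hg : Measurable g) (hfY : ∀ x, f x ∈ Ybar) (hgY : ∀ x, g x ∈ Ybar) :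
    Measurable (lossDiff ℓ f g) := by
  have hcont : ∀ y, Continuous fun u : Ybar => ℓ u y := fun y =>
    (LipschitzWith.of_dist_le_mul (K := L.toNNReal) fun u v => by
      rw [Real.dist_eq, Subtype.dist_eq, Real.dist_eq]
      exact (hloss.lipschitz y u u.2 v v.2).trans
        (mul_le_mul_of_nonneg_right (Real.le_coe_toNNReal L) (abs_nonneg _))).continuous
  have hm : Measurable (Function.uncurry fun (u : Ybar) (y : 𝒴) => ℓ u y) :=
    measurable_uncurry_of_continuous_of_measurable hcont fun u => hloss.measurable u u.2
  have key : ∀ k : 𝒳 → ℝ, Measurable k → (∀ x, k x ∈ Ybar) →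
      Measurable fun z : 𝒳 × 𝒴 => ℓ (k z.1) z.2 := fun k hk hkY =>
    hm.comp (((hk.comp measurable_fst).subtype_mk (h := fun z => hkY z.1)).prodMk measurable_snd)
  exact (key f hf hfY).sub (key g hg hgY)

lemma memLp_lossDiff (hloss : IsLipschitzConvexLoss Ybar ℓ L) (hf : Measurable f)
    (hg : Measurable g) (hfY : ∀ x, f x ∈ Ybar) (hgY : ∀ x, g x ∈ Ybar)
    (h : SubMemL2 Q f g) : MemLp (lossDiff ℓ f g) 2 Q :=
  h.of_le_mul (c := L) (measurable_lossDiff hloss hf hg hfY hgY).aestronglyMeasurable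
    (ae_of_all _ fun z => abs_lossDiff_le hloss hfY hgY z)

lemma sq_l2Dist (h : SubMemL2 Q f g) : l2Dist Q f g ^ 2 = ∫ z, (f z.1 - g z.1) ^ 2 ∂Q := by
  have h1 := h.eLpNorm_eq_integral_rpow_norm (by norm_num) (by norm_num)
  rw [l2Dist, h1, ENNReal.toReal_ofReal (by positivity), ← Real.rpow_natCast, ← Real.rpow_mul
    (by positivity)]
  simp

lemma integral_sq_lossDiff_le (hloss : IsLipschitzConvexLoss Ybar ℓ L)
    (hf : Measurable f) (hg : Measurable g) (hfY : ∀ x, f x ∈ Ybar) (hgY : ∀ x, g x ∈ Ybar)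
    (h : SubMemL2 Q f g) : ∫ z, lossDiff ℓ f g z ^ 2 ∂Q ≤ L ^ 2 * l2Dist Q f g ^ 2 := by
  rw [sq_l2Dist h, ← integral_const_mul]
  refine integral_mono (memLp_lossDiff hloss hf hg hfY hgY h).integrable_sq
    (h.integrable_sq.const_mul _) fun z => ?_
  simp only
  rw [← sq_abs, ← sq_abs (f z.1 - g z.1), ← mul_pow]
  exact pow_le_pow_left₀ (abs_nonneg _) (abs_lossDiff_le hloss hfY hgY z) 2

lemma l2Dist_nonneg : 0 ≤ l2Dist Q f g := ENNReal.toReal_nonneg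

lemma l2Dist_segment {c : ℝ} (hc : 0 ≤ c) :
    l2Dist Q (fs + c • (f - fs)) fs = c * l2Dist Q f fs := by
  have : (fun z : 𝒳 × 𝒴 => (fs + c • (f - fs)) z.1 - fs z.1) =
      c • fun z : 𝒳 × 𝒴 => f z.1 - fs z.1 := by
    ext z; simp
  rw [l2Dist, this, eLpNorm_const_smul, ENNReal.toReal_mul, l2Dist]
  simp [abs_of_nonneg hc]

end Loss

/-! ### From uniform deviations to the estimator (deterministic) -/

section Localization

variable {𝒳 𝒴 : Type*} [MeasurableSpace 𝒳] [MeasurableSpace 𝒴]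
  {Ybar : Set ℝ} {ℓ : ℝ → 𝒴 → ℝ} {L : ℝ} {P : Measure (𝒳 × 𝒴)} {F : Set (𝒳 → ℝ)} {fs : 𝒳 → ℝ}
  {N K : ℕ} {B : Fin K → Finset (Fin N)} {z : Fin N → 𝒳 × 𝒴} {A C : ℝ}

/-- Outside the ball, the block means are bounded from below, by convexity and the Bernstein
condition on the sphere. -/
lemma lt_card_blockMean_outside (hloss : IsLipschitzConvexLoss Ybar ℓ L)
    (hFval : ∀ f ∈ F, ∀ x, f x ∈ Ybar) (hFconv : Convex ℝ F) (hfs : IsOracle P ℓ F fs)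
    (hA : 0 < A) (hC : 0 < C) (hBern : LocalBernstein P ℓ F fs A C)
    (hdev : ∀ f ∈ F, l2Dist P f fs ^ 2 ≤ C → K < 2 * (Finset.univ.filter fun k =>
      |blockMean B z (lossDiff ℓ f fs) k - excessRisk P ℓ f fs| ≤ C / (3 * A)).card)
    {f : 𝒳 → ℝ} (hf : f ∈ F) (hfC : C < l2Dist P f fs ^ 2) :
    K < 2 * (Finset.univ.filter fun k =>
      2 * C / (3 * A) ≤ blockMean B z (lossDiff ℓ f fs) k).card := by
  set D := l2Dist P f fs with hD
  have hD0 : 0 ≤ D := l2Dist_nonneg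
  have hRD : √C < D := (Real.sqrt_lt' (by
    rcases hD0.eq_or_lt with h | h
    · rw [← h] at hfC; norm_num at hfC; linarith
    · exact h)).2 hfC
  have hR : 0 < √C := Real.sqrt_pos.2 hC
  have hDpos : 0 < D := hR.trans hRD
  -- The ratio that places `f₀` exactly on the sphere, where the Bernstein condition is available.
  set c := √C / D with hc
  have hc0 : 0 < c := by positivity
  have hc1 : c ≤ 1 := (div_le_one hDpos).2 hRD.le
  set f₀ := fs + c • (f - fs) with hf₀
  have hf₀F : f₀ ∈ F := segment_mem hFconv hfs.1 hf hc0.le hc1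
  have hdist : l2Dist P f₀ fs ^ 2 = C := by
    rw [hf₀, l2Dist_segment hc0.le, hc, ← hD, div_mul_cancel₀ _ hDpos.ne', Real.sq_sqrt hC.le]
  have hb := hBern f₀ hf₀F hdist
  rw [hdist] at hb
  refine card_lt_of_imp (hdev f₀ hf₀F hdist.le) fun k hk => ?_
  have h1 : blockMean B z (lossDiff ℓ f₀ fs) k ≤ c * blockMean B z (lossDiff ℓ f fs) k := by
    rw [blockMean, blockMean, ← mul_div_assoc, Finset.mul_sum]
    gcongr with i _
    exact lossDiff_segment_le hloss (hFval f hf) (hFval fs hfs.1) hc0.le hc1 _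
  have h2 := (abs_le.1 hk).1
  have h3 : C / A ≤ excessRisk P ℓ f₀ fs := (div_le_iff₀' hA).2 hb
  have h4 : C / A = 3 * (C / (3 * A)) := by field_simp
  have h5 : 2 * C / (3 * A) = 2 * (C / (3 * A)) := by ring
  have h6 : 0 < C / (3 * A) := by positivity
  rw [h5]
  -- Positivity comes first: only for a positive mean does `c ≤ 1` give that the mean at `f` is at
  -- least `c` times itself, hence at least the mean at `f₀`.
  have h7 : 0 < c * blockMean B z (lossDiff ℓ f fs) k := by linarith
  have h8 : 0 < blockMean B z (lossDiff ℓ f fs) k := pos_of_mul_pos_right h7 hc0.le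
  nlinarith

/-- If, uniformly over a ball, a majority of the block means are close to the excess risk, then
every minmax MOM estimator is in the ball and has a small excess risk. -/
theorem IsMinmaxMOM.localized (hloss : IsLipschitzConvexLoss Ybar ℓ L)
    (hFval : ∀ f ∈ F, ∀ x, f x ∈ Ybar) (hFconv : Convex ℝ F) (hfs : IsOracle P ℓ F fs)
    (hA : 0 < A) (hC : 0 < C) (hBern : LocalBernstein P ℓ F fs A C)
    (hdev : ∀ f ∈ F, l2Dist P f fs ^ 2 ≤ C → K < 2 * (Finset.univ.filter fun k =>
      |blockMean B z (lossDiff ℓ f fs) k - excessRisk P ℓ f fs| ≤ C / (3 * A)).card)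
    {fhat : 𝒳 → ℝ} (hfhat : IsMinmaxMOM ℓ F B z fhat) :
    l2Dist P fhat fs ^ 2 ≤ C ∧ excessRisk P ℓ fhat fs ≤ 2 / (3 * A) * C := by
  have h6 : 0 < C / (3 * A) := by positivity
  have hcrit : minmaxCriterion ℓ F B z fs ≤ ((C / (3 * A) : ℝ) : EReal) := by
    refine iSup₂_le fun g hg => EReal.coe_le_coe_iff.2 (median_le ?_)
    rcases le_or_gt (l2Dist P g fs ^ 2) C with h | h
    -- Inside the ball, the nonnegative excess risk of `g` only helps.
    · refine card_lt_of_imp (hdev g hg h) fun k hk => ?_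
      have h1 := blockMean_lossDiff_neg (B := B) (z := z) (ℓ := ℓ) (fs := fs) g k
      rw [blockMean] at h1
      rw [h1]
      linarith [(abs_le.1 hk).1, hfs.2 g hg]
    · refine card_lt_of_imp (lt_card_blockMean_outside hloss hFval hFconv hfs hA hC hBern hdev
        hg h) fun k hk => ?_
      have h1 := blockMean_lossDiff_neg (B := B) (z := z) (ℓ := ℓ) (fs := fs) g k
      rw [blockMean] at h1
      rw [h1]
      have h5 : 2 * C / (3 * A) = 2 * (C / (3 * A)) := by ring
      linarith
  have hmed : median (blockMean B z (lossDiff ℓ fhat fs)) ≤ C / (3 * A) := by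
    have h1 : ((medianOfMeans B z (lossDiff ℓ fhat fs) : ℝ) : EReal) ≤
        minmaxCriterion ℓ F B z fhat :=
      le_iSup₂ (f := fun g (_ : g ∈ F) => ((medianOfMeans B z (lossDiff ℓ fhat g) : ℝ) : EReal))
        fs hfs.1
    exact EReal.coe_le_coe_iff.1 (h1.trans ((hfhat.2 fs hfs.1).trans hcrit))
  have hball : l2Dist P fhat fs ^ 2 ≤ C := by
    by_contra! h
    have h1 := le_median (lt_card_blockMean_outside hloss hFval hFconv hfs hA hC hBern hdev
        hfhat.1 h)
    have h5 : 2 * C / (3 * A) = 2 * (C / (3 * A)) := by ring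
    have h2 : median (fun k => blockMean B z (lossDiff ℓ fhat fs) k) =
      median (blockMean B z (lossDiff ℓ fhat fs)) := rfl
    linarith
  refine ⟨hball, ?_⟩
  have h1 : excessRisk P ℓ fhat fs - C / (3 * A) ≤ median (blockMean B z (lossDiff ℓ fhat fs)) :=
    le_median (card_lt_of_imp (hdev fhat hfhat.1 hball) fun k hk => by
      linarith [(abs_le.1 hk).1])
  have h5 : 2 / (3 * A) * C = 2 * (C / (3 * A)) := by ring
  linarith

end Localization

/-! ### Scaling and restriction of the Rademacher complexity -/

section Complexity

/-- Restricting a sign vector to a subset of the coordinates preserves the averages. -/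
lemma sum_signs_restrict {ι : Type*} [Fintype ι] [DecidableEq ι] (p : ι → Prop) [DecidablePred p]
    [Fintype {i // p i}] (G : ({i // p i} → ℤˣ) → ℝ) :
    2 ^ Fintype.card {i // p i} * ∑ σ : ι → ℤˣ, G (fun i => σ i) =
      2 ^ Fintype.card ι * ∑ ε : {i // p i} → ℤˣ, G ε := by
  have h1 : ∑ σ : ι → ℤˣ, G (fun i => σ i) =
      2 ^ Fintype.card {i // ¬p i} * ∑ ε : {i // p i} → ℤˣ, G ε := by
    rw [← (Equiv.piEquivPiSubtypeProd p fun _ => ℤˣ).symm.sum_comp, Fintype.sum_prod_type,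
      Finset.mul_sum]
    refine Finset.sum_congr rfl fun ε _ => ?_
    have : ∀ τ : {i // ¬p i} → ℤˣ, (fun i : {i // p i} =>
        (Equiv.piEquivPiSubtypeProd p fun _ => ℤˣ).symm (ε, τ) i) = ε := fun τ => by
      funext i
      simp [Equiv.piEquivPiSubtypeProd, i.2]
    simp only [this, Finset.sum_const, Finset.card_univ, Fintype.card_fun,
      Fintype.card_units_int, nsmul_eq_mul, Nat.cast_pow, Nat.cast_ofNat]
  have h2 : Fintype.card ι = Fintype.card {i // p i} + Fintype.card {i // ¬p i} := by
    rw [Fintype.card_subtype_compl]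
    have := Fintype.card_subtype_le p
    omega
  rw [h1, h2, pow_add]
  ring

variable {Ω 𝒳 𝒴 : Type*} [MeasurableSpace Ω] [MeasurableSpace 𝒳] [MeasurableSpace 𝒴]
  {Pr : Measure Ω} {P : Measure (𝒳 × 𝒴)} {F : Set (𝒳 → ℝ)} {fs : 𝒳 → ℝ} {N : ℕ}
  {Z : Fin N → Ω → 𝒳 × 𝒴} {J : Finset (Fin N)}

/-- The complexity is star-shaped: it grows at most linearly with the radius. -/
lemma rademacherComplexity_le_mul (hF : Convex ℝ F) (hfs : fs ∈ F) {r R : ℝ} (hr : 0 < r)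
    (hrR : r ≤ R) : rademacherComplexity Pr P F fs Z J R ≤
      ENNReal.ofReal (R / r) * rademacherComplexity Pr P F fs Z J r := by
  have hR : 0 < R := hr.trans_le hrR
  rw [rademacherComplexity, rademacherComplexity, ← mul_div_assoc, Finset.mul_sum]
  refine ENNReal.div_le_div_right (Finset.sum_le_sum fun σ _ => ?_) _
  rw [← lintegral_const_mul' _ _ ENNReal.ofReal_ne_top]
  refine lintegral_mono fun ω => iSup₂_le fun f hf => ?_
  -- Shrinking `f` towards `fs` by the factor `r / R` maps the large ball into the small one and
  -- scales every summand by the same factor.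
  have hg : fs + (r / R) • (f - fs) ∈ {f ∈ F | l2Dist P f fs ≤ r} := by
    refine ⟨segment_mem hF hfs hf.1 (by positivity) ((div_le_one hR).2 hrR), ?_⟩
    rw [l2Dist_segment (by positivity)]
    calc r / R * l2Dist P f fs ≤ r / R * R := by gcongr; exact hf.2
      _ = r := div_mul_cancel₀ _ hR.ne'
  refine le_trans (le_of_eq ?_) (mul_le_mul_right (le_iSup₂ (f := fun f (_ : f ∈ {f ∈ F |
    l2Dist P f fs ≤ r}) => ENNReal.ofReal |∑ i ∈ J, ((σ i : ℤ) : ℝ) *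
      (f (Z i ω).1 - fs (Z i ω).1)|) _ hg) _)
  rw [← ENNReal.ofReal_mul (by positivity)]
  congr 1
  have e : ∑ i ∈ J, ((σ i : ℤ) : ℝ) *
        ((fs + (r / R) • (f - fs)) (Z i ω).1 - fs (Z i ω).1) =
      r / R * ∑ i ∈ J, ((σ i : ℤ) : ℝ) * (f (Z i ω).1 - fs (Z i ω).1) := by
    rw [Finset.mul_sum]
    refine Finset.sum_congr rfl fun i _ => ?_
    simp only [Pi.add_apply, Pi.smul_apply, Pi.sub_apply, smul_eq_mul]
    ring
  rw [e, abs_mul, abs_of_pos (div_pos hr hR), ← mul_assoc, div_mul_div_comm, mul_comm R r,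
    div_self (by positivity), one_mul]

lemma rademacherComplexity_mono {r R : ℝ} (hrR : r ≤ R) :
    rademacherComplexity Pr P F fs Z J r ≤ rademacherComplexity Pr P F fs Z J R := by
  refine ENNReal.div_le_div_right (Finset.sum_le_sum fun σ _ => lintegral_mono fun ω => ?_) _
  exact biSup_mono fun f hf => ⟨hf.1, hf.2.trans hrR⟩

/-- A radius that is at least a complexity parameter satisfies the complexity bound up to an
arbitrarily small factor. -/
lemma IsComplexityParameter.rademacherComplexity_le (hF : Convex ℝ F) (hfs : fs ∈ F)
    {I : Finset (Fin N)} {γ r₂ R R' : ℝ} (hγ : 0 ≤ γ)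
    (h : IsComplexityParameter Pr P F fs Z I γ r₂) (hR : 0 < R) (hr₂ : r₂ ≤ R) (hRR' : R < R')
    (hJ : J ⊆ I) (hJN : (N : ℝ) / 2 ≤ J.card) :
    rademacherComplexity Pr P F fs Z J R ≤ ENNReal.ofReal (R' ^ 2 * J.card * γ) := by
  -- The infimum need not be attained, so the bound is known only at some `r < R'`, on either side
  -- of `R`: scaling handles `r ≤ R`, monotonicity the rest.
  obtain ⟨r, ⟨hr0, hr⟩, hrR'⟩ := exists_lt_of_csInf_lt h.1 ((h.2.trans hr₂).trans_lt hRR')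
  have hrJ := hr J hJ hJN
  rcases le_total r R with h1 | h1
  · refine (rademacherComplexity_le_mul hF hfs hr0 h1).trans
      ((mul_le_mul_right hrJ _).trans ?_)
    rw [← ENNReal.ofReal_mul (by positivity)]
    refine ENNReal.ofReal_le_ofReal ?_
    calc R / r * (r ^ 2 * J.card * γ) = (R * r) * J.card * γ := by field_simp
      _ ≤ R' ^ 2 * J.card * γ := by
        have : R * r ≤ R' ^ 2 := by nlinarith
        gcongr
  · refine (rademacherComplexity_mono h1).trans (hrJ.trans (ENNReal.ofReal_le_ofReal ?_))
    have : r ^ 2 ≤ R' ^ 2 := by nlinarith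
    gcongr

/-- The Rademacher averages of finite subclasses, over signs that are indexed by a subset of the
indices, are bounded by the complexity. -/
lemma sum_signs_integral_iSup_le {T : Type*} [Finite T] [Nonempty T] {p : Fin N → Prop}
    [DecidablePred p] [Fintype {i // p i}] {g : T → 𝒳 → ℝ} {r c : ℝ} (hc : 0 ≤ c)
    (hg : ∀ t, g t ∈ F ∧ l2Dist P (g t) fs ≤ r) {J : Finset {i // p i}}
    (hint : ∀ t (i : {i // p i}), Integrable (fun ω => g t (Z i ω).1 - fs (Z i ω).1) Pr)
    (h : rademacherComplexity Pr P F fs Z (J.map (Function.Embedding.subtype p)) r ≤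
      ENNReal.ofReal c) :
    ∑ ε : {i // p i} → ℤˣ, ∫ ω, ⨆ t, ∑ i ∈ J, ((ε i : ℤ) : ℝ) *
      (g t (Z i ω).1 - fs (Z i ω).1) ∂Pr ≤ 2 ^ Fintype.card {i // p i} * c := by
  let x (ε : {i // p i} → ℤˣ) (t : T) (ω : Ω) : ℝ :=
    ∑ i ∈ J, ((ε i : ℤ) : ℝ) * (g t (Z i ω).1 - fs (Z i ω).1)
  have hx : ∀ ε t, Integrable (x ε t) Pr := fun ε t =>
    integrable_finsetSum _ fun i _ => (hint t i).const_mul _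
  let G (ε : {i // p i} → ℤˣ) : ℝ := ∫ ω, ⨆ t, |x ε t ω| ∂Pr
  have hG0 : ∀ ε, 0 ≤ G ε := fun ε =>
    integral_nonneg fun ω => Real.iSup_nonneg fun t => abs_nonneg _
  have hxG : ∀ ε, ∫ ω, ⨆ t, x ε t ω ∂Pr ≤ G ε := fun ε =>
    integral_mono (Integrable.iSup_finite (hx ε)) (Integrable.iSup_finite fun t => (hx ε t).abs)
      fun ω => ciSup_mono (Set.finite_range _).bddAbove fun t => le_abs_self _
  have hsum : ∀ σ : Fin N → ℤˣ, ENNReal.ofReal (G fun i => σ i) ≤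
      ∫⁻ ω, ⨆ f ∈ {f ∈ F | l2Dist P f fs ≤ r}, ENNReal.ofReal
        |∑ i ∈ J.map (Function.Embedding.subtype p), ((σ i : ℤ) : ℝ) *
          (f (Z i ω).1 - fs (Z i ω).1)| ∂Pr := by
    intro σ
    rw [ofReal_integral_eq_lintegral_ofReal (Integrable.iSup_finite fun t => (hx _ t).abs)
      (ae_of_all _ fun ω => Real.iSup_nonneg fun t => abs_nonneg _)]
    refine lintegral_mono fun ω => ?_
    obtain ⟨t, ht⟩ := exists_eq_ciSup_of_finite (f := fun t => |x (fun i => σ i) t ω|)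
    simp only
    rw [← ht]
    refine le_trans (le_of_eq ?_) (le_iSup₂ (f := fun f (_ : f ∈ {f ∈ F | l2Dist P f fs ≤ r}) =>
      ENNReal.ofReal |∑ i ∈ J.map (Function.Embedding.subtype p), ((σ i : ℤ) : ℝ) *
          (f (Z i ω).1 - fs (Z i ω).1)|) (g t) (hg t))
    simp only [Finset.sum_map, x]
    rfl
  have h2 : ∑ σ : Fin N → ℤˣ, G (fun i => σ i) ≤ 2 ^ N * c := by
    rw [← ENNReal.ofReal_le_ofReal_iff (by positivity),
      ENNReal.ofReal_sum_of_nonneg fun σ _ => hG0 _, ENNReal.ofReal_mul (by positivity)]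
    refine (Finset.sum_le_sum fun σ _ => hsum σ).trans ?_
    rw [rademacherComplexity, ENNReal.div_le_iff (by positivity) (by simp)] at h
    refine h.trans (le_of_eq ?_)
    rw [mul_comm, ENNReal.ofReal_pow (by norm_num), ENNReal.ofReal_ofNat]
  -- The complexity averages over signs for all `N` indices, the symmetrization only over those
  -- satisfying `p`; the two averages agree.
  have h3 := sum_signs_restrict p G
  rw [Fintype.card_fin] at h3
  have h4 : ∑ ε : {i // p i} → ℤˣ, G ε ≤ 2 ^ Fintype.card {i // p i} * c := by
    refine le_of_mul_le_mul_left (a := (2 : ℝ) ^ N) ?_ (by positivity)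
    rw [← h3]
    calc _ ≤ (2 : ℝ) ^ Fintype.card {i // p i} * (2 ^ N * c) := by gcongr
      _ = _ := by ring
  exact (Finset.sum_le_sum fun ε _ => hxG ε).trans h4

end Complexity

/-! ### Counting clean blocks and inliers -/

section Counting

variable {N K : ℕ} {B : Fin K → Finset (Fin N)} {O : Finset (Fin N)}

/-- The blocks without outliers. -/
def cleanBlocks (B : Fin K → Finset (Fin N)) (O : Finset (Fin N)) : Finset (Fin K) :=
  Finset.univ.filter fun k => Disjoint (B k) O

/-- Blocks are disjoint, so an outlier spoils at most one. -/
lemma le_card_cleanBlocks_add (hB : AreBlocks B) : K ≤ (cleanBlocks B O).card + O.card := by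
  have h1 : (Finset.univ.filter fun k => ¬ Disjoint (B k) O).card ≤ O.card := by
    have h : ∀ k ∈ Finset.univ.filter fun k => ¬ Disjoint (B k) O, ∃ i ∈ O, i ∈ B k := by
      intro k hk
      obtain ⟨i, hi, hiO⟩ := Finset.not_disjoint_iff.1 (Finset.mem_filter.1 hk).2
      exact ⟨i, hiO, hi⟩
    refine Finset.card_le_card_of_forall_subsingleton (fun k i => i ∈ B k) h fun i _ k hk l hl => ?_
    by_contra hkl
    exact Finset.disjoint_left.1 (hB.disjoint hkl) hk.2 hl.2
  have h2 := Finset.card_filter_add_card_filter_not (s := (Finset.univ : Finset (Fin K)))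
    fun k => Disjoint (B k) O
  rw [Finset.card_univ, Fintype.card_fin] at h2
  rw [cleanBlocks]
  omega

/-- The points of the clean blocks are contained in a set of inliers that is large enough for the
complexity bound, but not much larger. -/
lemma exists_superset_cleanBlocks (hB : AreBlocks B) (hK : 0 < K) (hKN : K ≤ N)
    (hON : 7 * O.card ≤ 3 * N) (hOK : 7 * O.card ≤ 3 * K) :
    ∃ J ⊆ Oᶜ, (∀ k ∈ cleanBlocks B O, B k ⊆ J) ∧ N ≤ 2 * J.card ∧
      4 * J.card ≤ 7 * ((cleanBlocks B O).card * (N / K)) := by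
  have hn := le_card_cleanBlocks_add (O := O) hB
  set n := (cleanBlocks B O).card with hn'
  set U := (cleanBlocks B O).biUnion B with hU
  have hUcard : U.card = n * (N / K) := by
    rw [hU, Finset.card_biUnion fun k _ l _ hkl => hB.disjoint hkl]
    simp [hB.card_eq, hn']
  have hUO : U ⊆ Oᶜ := Finset.biUnion_subset.2 fun k hk i hi =>
    Finset.mem_compl.2 (Finset.disjoint_left.1 (Finset.mem_filter.1 hk).2 hi)
  have hBU : ∀ k ∈ cleanBlocks B O, B k ⊆ U := fun k hk => Finset.subset_biUnion_of_mem B hk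
  have hO : Oᶜ.card = N - O.card := by rw [Finset.card_compl, Fintype.card_fin]
  have hq : 1 ≤ N / K := (Nat.one_le_div_iff hK).2 hKN
  have hdiv := Nat.div_add_mod N K
  have hmod := Nat.mod_lt N hK
  have hKq : K ≤ K * (N / K) := Nat.le_mul_of_pos_right K hq
  have h4 : 4 * (K * (N / K)) ≤ 7 * (n * (N / K)) := by
    have : (4 * K) * (N / K) ≤ (7 * n) * (N / K) := Nat.mul_le_mul_right _ (by omega)
    linarith
  rcases le_or_gt N (2 * (n * (N / K))) with h | h
  · exact ⟨U, hUO, hBU, by omega, by omega⟩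
  -- When the clean blocks cover fewer than `N / 2` points, they are padded with inliers to exactly
  -- `⌈N/2⌉`. The upper bound survives since `N + 1 ≤ 2K⌊N/K⌋` and at least `4K/7` blocks are clean.
  · obtain ⟨J, hUJ, hJO, hJ⟩ := Finset.exists_subsuperset_card_eq (n := (N + 1) / 2) hUO
      (by omega) (by omega)
    exact ⟨J, hJO, fun k hk => (hBU k hk).trans hUJ, by omega, by omega⟩

end Counting

/-! ### From a countable dense subset to the whole ball -/

section Approximation

variable {𝒳 𝒴 : Type*} [MeasurableSpace 𝒳] [MeasurableSpace 𝒴]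
  {Ybar : Set ℝ} {ℓ : ℝ → 𝒴 → ℝ} {L : ℝ} {P : Measure (𝒳 × 𝒴)} {F : Set (𝒳 → ℝ)} {f g fs : 𝒳 → ℝ}

lemma SubMemL2.sub (hf : SubMemL2 P f fs) (hg : SubMemL2 P g fs) : SubMemL2 P f g := by
  have := MemLp.sub hf hg
  refine this.ae_eq (ae_of_all _ fun z => ?_)
  simp

lemma l2Dist_triangle (hf : SubMemL2 P f g) (hg : SubMemL2 P g fs) :
    l2Dist P f fs ≤ l2Dist P f g + l2Dist P g fs := by
  rw [l2Dist, l2Dist, l2Dist, ← ENNReal.toReal_add hf.eLpNorm_ne_top hg.eLpNorm_ne_top]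
  refine ENNReal.toReal_mono (ENNReal.add_ne_top.2 ⟨hf.eLpNorm_ne_top, hg.eLpNorm_ne_top⟩) ?_
  have h1 := eLpNorm_add_le hf.aestronglyMeasurable hg.aestronglyMeasurable one_le_two
  have h2 : ((fun z : 𝒳 × 𝒴 => f z.1 - g z.1) + fun z : 𝒳 × 𝒴 => g z.1 - fs z.1) =
      fun z => f z.1 - fs z.1 := by
    ext z; simp
  rwa [h2] at h1

variable [IsProbabilityMeasure P]

lemma abs_excessRisk_sub_le (hL : 0 ≤ L) (hloss : IsLipschitzConvexLoss Ybar ℓ L)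
    (hf : Measurable f) (hg : Measurable g) (hfs : Measurable fs) (hfY : ∀ x, f x ∈ Ybar)
    (hgY : ∀ x, g x ∈ Ybar) (hfsY : ∀ x, fs x ∈ Ybar) (hf2 : SubMemL2 P f fs)
    (hg2 : SubMemL2 P g fs) :
    |excessRisk P ℓ f fs - excessRisk P ℓ g fs| ≤ L * l2Dist P f g := by
  have hfg := hf2.sub hg2
  have h1 := (memLp_lossDiff hloss hf hfs hfY hfsY hf2).integrable one_le_two
  have h2 := (memLp_lossDiff hloss hg hfs hgY hfsY hg2).integrable one_le_two
  have h3 : ∫ z, |f z.1 - g z.1| ∂P ≤ l2Dist P f g := by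
    have h4 := integral_norm_eq_lintegral_enorm (μ := P) hfg.aestronglyMeasurable
    simp only [Real.norm_eq_abs] at h4
    rw [h4, ← eLpNorm_one_eq_lintegral_enorm]
    exact ENNReal.toReal_mono hfg.eLpNorm_ne_top
      (eLpNorm_le_eLpNorm_of_exponent_le one_le_two hfg.aestronglyMeasurable)
  rw [excessRisk, excessRisk, ← integral_sub h1 h2]
  calc _ ≤ ∫ z, |lossDiff ℓ f fs z - lossDiff ℓ g fs z| ∂P := abs_integral_le_integral_abs
    _ ≤ ∫ z, L * |f z.1 - g z.1| ∂P := by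
      refine integral_mono (h1.sub h2).abs ((hfg.integrable one_le_two).abs.const_mul _) fun z => ?_
      have := abs_lossDiff_le hloss hfY hgY z
      simpa [lossDiff] using this
    _ ≤ _ := by
      rw [integral_const_mul]
      gcongr

/-- A sum of truncated deviations of block means. -/
noncomputable def rampSum (P : Measure (𝒳 × 𝒴)) (ℓ : ℝ → 𝒴 → ℝ) (fs : 𝒳 → ℝ) {N K : ℕ}
    (B : Fin K → Finset (Fin N)) (S : Finset (Fin K)) (s : ℝ) (z : Fin N → 𝒳 × 𝒴)
    (f : 𝒳 → ℝ) : ℝ :=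
  ∑ k ∈ S, ramp s (blockMean B z (lossDiff ℓ f fs) k - excessRisk P ℓ f fs)

variable {N K : ℕ} {B : Fin K → Finset (Fin N)} {S : Finset (Fin K)} {s : ℝ}
  {z : Fin N → 𝒳 × 𝒴}

lemma tendsto_rampSum (hL : 0 ≤ L) (hloss : IsLipschitzConvexLoss Ybar ℓ L)
    (hFmeas : ∀ f ∈ F, Measurable f) (hFval : ∀ f ∈ F, ∀ x, f x ∈ Ybar)
    (hFL2 : ∀ f ∈ F, SubMemL2 P f fs) (hfs : fs ∈ F) (hf : f ∈ F) {u : ℕ → 𝒳 → ℝ}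
    (hu : ∀ n, u n ∈ F) (hux : ∀ x, Tendsto (fun n => u n x) atTop (𝓝 (f x)))
    (hu2 : Tendsto (fun n => l2Dist P (u n) f) atTop (𝓝 0)) :
    Tendsto (fun n => rampSum P ℓ fs B S s z (u n)) atTop (𝓝 (rampSum P ℓ fs B S s z f)) := by
  have hrisk : Tendsto (fun n => excessRisk P ℓ (u n) fs) atTop (𝓝 (excessRisk P ℓ f fs)) := by
    rw [tendsto_iff_norm_sub_tendsto_zero]
    refine squeeze_zero (fun _ => norm_nonneg _) (fun n => abs_excessRisk_sub_le hL hloss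
      (hFmeas _ (hu n)) (hFmeas f hf) (hFmeas fs hfs) (hFval _ (hu n)) (hFval f hf)
      (hFval fs hfs) (hFL2 _ (hu n)) (hFL2 f hf)) ?_
    simpa using hu2.const_mul L
  have hloss' : ∀ w : 𝒳 × 𝒴, Tendsto (fun n => lossDiff ℓ (u n) fs w) atTop
      (𝓝 (lossDiff ℓ f fs w)) := by
    intro w
    rw [tendsto_iff_norm_sub_tendsto_zero]
    refine squeeze_zero (g := fun n => L * |u n w.1 - f w.1|) (fun _ => norm_nonneg _)
      (fun n => ?_) ?_
    · have := abs_lossDiff_le hloss (hFval _ (hu n)) (hFval f hf) w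
      simpa [lossDiff] using this
    · have := (tendsto_iff_norm_sub_tendsto_zero.1 (hux w.1)).const_mul L
      simpa using this
  refine tendsto_finsetSum _ fun k _ => ((continuous_ramp s).tendsto _).comp (Tendsto.sub ?_ hrisk)
  exact (tendsto_finsetSum _ fun i _ => hloss' (z i)).div_const _

/-- A bound on the truncated deviations over a countable dense subset extends to the ball. -/
lemma rampSum_le_of_dense (hL : 0 ≤ L) (hloss : IsLipschitzConvexLoss Ybar ℓ L)
    (hFmeas : ∀ f ∈ F, Measurable f) (hFval : ∀ f ∈ F, ∀ x, f x ∈ Ybar) (hFconv : Convex ℝ F)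
    (hFL2 : ∀ f ∈ F, SubMemL2 P f fs) (hfs : fs ∈ F) {F₀ : Set (𝒳 → ℝ)} (hF₀ : F₀ ⊆ F)
    (hdense : ∀ f ∈ F, ∃ u : ℕ → 𝒳 → ℝ, (∀ n, u n ∈ F₀) ∧
      (∀ x, Tendsto (fun n => u n x) atTop (𝓝 (f x))) ∧
      Tendsto (fun n => eLpNorm (fun z : 𝒳 × 𝒴 => u n z.1 - f z.1) 2 P) atTop (𝓝 0))
    {R b : ℝ} (hR : 0 < R)
    (h : ∀ f ∈ F₀, l2Dist P f fs ≤ R → rampSum P ℓ fs B S s z f ≤ b) :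
    ∀ f ∈ F, l2Dist P f fs ≤ R → rampSum P ℓ fs B S s z f ≤ b := by
  -- Approximants from `F₀` are eventually in the ball only when `f` is strictly inside it.
  have hopen : ∀ f ∈ F, l2Dist P f fs < R → rampSum P ℓ fs B S s z f ≤ b := by
    intro f hf hfR
    obtain ⟨u, hu, hux, hu2⟩ := hdense f hf
    have hu2' : Tendsto (fun n => l2Dist P (u n) f) atTop (𝓝 0) :=
      (ENNReal.tendsto_toReal ENNReal.zero_ne_top).comp hu2
    refine le_of_tendsto (tendsto_rampSum hL hloss hFmeas hFval hFL2 hfs hf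
      (fun n => hF₀ (hu n)) hux hu2') ?_
    filter_upwards [hu2'.eventually_lt_const (sub_pos.2 hfR)] with n hn
    refine h _ (hu n) ?_
    have := l2Dist_triangle ((hFL2 _ (hF₀ (hu n))).sub (hFL2 f hf)) (hFL2 f hf)
    linarith
  intro f hf hfR
  -- Points of the sphere are reached from the open ball along the segment from `fs`, with factors
  -- increasing to `1`.
  let c : ℕ → ℝ := fun n => 1 - 1 / ((n : ℝ) + 1)
  have hc0 : ∀ n, 0 ≤ c n := fun n => by
    have : 1 / ((n : ℝ) + 1) ≤ 1 := by
      rw [div_le_one (by positivity)]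
      linarith [(Nat.cast_nonneg n : (0 : ℝ) ≤ n)]
    simp only [c]; linarith
  have hc1 : ∀ n, c n < 1 := fun n => by
    have : 0 < 1 / ((n : ℝ) + 1) := by positivity
    simp only [c]; linarith
  have hc : Tendsto (fun n => 1 - c n) atTop (𝓝 0) := by
    simpa [c] using tendsto_one_div_add_atTop_nhds_zero_nat (𝕜 := ℝ)
  have hmem : ∀ n, fs + c n • (f - fs) ∈ F := fun n =>
    segment_mem hFconv hfs hf (hc0 n) (hc1 n).le
  refine le_of_tendsto (tendsto_rampSum hL hloss hFmeas hFval hFL2 hfs hf hmem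
    (fun x => ?_) ?_) (Eventually.of_forall fun n => hopen _ (hmem n) ?_)
  · have h1 := (hc.mul_const (f x - fs x)).const_sub (f x)
    rw [zero_mul, sub_zero] at h1
    refine h1.congr fun n => ?_
    simp only [Pi.add_apply, Pi.smul_apply, Pi.sub_apply, smul_eq_mul]
    ring
  · have h1 : ∀ n, l2Dist P (fs + c n • (f - fs)) f = (1 - c n) * l2Dist P fs f := by
      intro n
      have e : fs + c n • (f - fs) = f + (1 - c n) • (fs - f) := by
        ext x
        simp only [Pi.add_apply, Pi.smul_apply, Pi.sub_apply, smul_eq_mul]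
        ring
      rw [e, l2Dist_segment (sub_nonneg.2 (hc1 n).le)]
    simp only [h1]
    simpa using hc.mul_const (l2Dist P fs f)
  · rw [l2Dist_segment (hc0 n)]
    calc c n * l2Dist P f fs ≤ c n * R := mul_le_mul_of_nonneg_left hfR (hc0 n)
      _ < 1 * R := mul_lt_mul_of_pos_right (hc1 n) hR
      _ = R := one_mul R

end Approximation

/-! ### The event and the proof of the theorem -/

section Main

variable {Ω 𝒳 𝒴 : Type*} [MeasurableSpace Ω] [MeasurableSpace 𝒳] [MeasurableSpace 𝒴]
  {Pr : Measure Ω} {P : Measure (𝒳 × 𝒴)}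
  {Ybar : Set ℝ} {ℓ : ℝ → 𝒴 → ℝ} {L : ℝ} {F : Set (𝒳 → ℝ)} {fs : 𝒳 → ℝ} {N K : ℕ}
  {Z : Fin N → Ω → 𝒳 × 𝒴} {O : Finset (Fin N)} {B : Fin K → Finset (Fin N)}

/-- Only clean blocks enter, so no measurability of the outliers is involved. -/
lemma AreInliers.measurable_rampSum (hloss : IsLipschitzConvexLoss Ybar ℓ L)
    (hFmeas : ∀ f ∈ F, Measurable f) (hFval : ∀ f ∈ F, ∀ x, f x ∈ Ybar) (hfs : fs ∈ F)
    (hI : AreInliers Pr P ℓ F fs Z Oᶜ) (s : ℝ) {f : 𝒳 → ℝ} (hf : f ∈ F) :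
    Measurable fun ω => rampSum P ℓ fs B (cleanBlocks B O) s (fun i => Z i ω) f := by
  refine Finset.measurable_sum _ fun k hk => (continuous_ramp s).measurable.comp
    (((Finset.measurable_sum _ fun i hi => ?_).div_const _).sub_const _)
  have hiO : i ∈ Oᶜ :=
    Finset.mem_compl.2 (Finset.disjoint_left.1 (Finset.mem_filter.1 hk).2 hi)
  exact (measurable_lossDiff hloss (hFmeas f hf) (hFmeas fs hfs) (hFval f hf)
    (hFval fs hfs)).comp (hI.measurable i hiO)

variable [IsProbabilityMeasure Pr]

/-- The deviation bound for a finite subclass, in terms of the complexity of a set of inliers that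
contains the clean blocks. -/
lemma AreInliers.measureReal_rampSum_gt_le (hL : 0 < L) (hloss : IsLipschitzConvexLoss Ybar ℓ L)
    (hFmeas : ∀ f ∈ F, Measurable f) (hFval : ∀ f ∈ F, ∀ x, f x ∈ Ybar) (hfs : fs ∈ F)
    (hI : AreInliers Pr P ℓ F fs Z Oᶜ) (hB : AreBlocks B) (hNK : 0 < N / K)
    (hn : (cleanBlocks B O).Nonempty) {J : Finset (Fin N)} (hJO : J ⊆ Oᶜ)
    (hJ : ∀ k ∈ cleanBlocks B O, B k ⊆ J) {R c s δ : ℝ} (hc : 0 ≤ c) (hs : 0 < s)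
    (hδ : 0 ≤ δ) (hcomp : rademacherComplexity Pr P F fs Z J R ≤ ENNReal.ofReal c)
    {T : Type*} [Finite T] {g : T → 𝒳 → ℝ} (hg : ∀ t, g t ∈ F ∧ l2Dist P (g t) fs ≤ R) :
    Pr.real {ω | ∃ t, (cleanBlocks B O).card * (L ^ 2 * R ^ 2 / ((N / K : ℕ) * s ^ 2) + δ) +
      8 * L / (s * (N / K : ℕ)) * c <
        rampSum P ℓ fs B (cleanBlocks B O) s (fun i => Z i ω) (g t)} ≤
      Real.exp (-(2 * (cleanBlocks B O).card * δ ^ 2)) := by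
  cases isEmpty_or_nonempty T
  · simpa using (Real.exp_pos _).le
  -- Clean blocks and their points are reindexed by subtypes, because independence is available for
  -- the inliers only.
  let b : {k // k ∈ cleanBlocks B O} → Finset {i // i ∈ Oᶜ} := fun k =>
    (B k).subtype (· ∈ Oᶜ)
  have hBO : ∀ k ∈ cleanBlocks B O, ∀ i ∈ B k, i ∈ Oᶜ := fun k hk i hi =>
    Finset.mem_compl.2 (Finset.disjoint_left.1 (Finset.mem_filter.1 hk).2 hi)
  have hb : Pairwise fun k l => Disjoint (b k) (b l) := by
    intro k l hkl
    refine Finset.disjoint_left.2 fun i hi hi' => ?_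
    exact Finset.disjoint_left.1 (hB.disjoint fun h => hkl (Subtype.ext h))
      (Finset.mem_subtype.1 hi) (Finset.mem_subtype.1 hi')
  have hbq : ∀ k, (b k).card = N / K := fun k => by
    rw [Finset.card_subtype, Finset.filter_true_of_mem (hBO k k.2), hB.card_eq]
  have hξ : ∀ i : {i // i ∈ Oᶜ}, Measurable (Z i) := fun i => hI.measurable i i.2
  have hlm : ∀ t, Measurable (lossDiff ℓ (g t) fs : 𝒳 × 𝒴 → ℝ) := fun t =>
    measurable_lossDiff hloss (hFmeas _ (hg t).1) (hFmeas fs hfs) (hFval _ (hg t).1)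
      (hFval fs hfs)
  have hLp : ∀ t (i : {i // i ∈ Oᶜ}), MemLp (lossDiff ℓ (g t) fs) 2 (Pr.map (Z i)) := fun t i =>
    memLp_lossDiff hloss (hFmeas _ (hg t).1) (hFmeas fs hfs) (hFval _ (hg t).1)
      (hFval fs hfs) (hI.memL2 i i.2 _ (hg t).1)
  have hprob : ∀ i : {i // i ∈ Oᶜ}, IsProbabilityMeasure (Pr.map (Z i)) := fun i =>
    Measure.isProbabilityMeasure_map (hξ i).aemeasurable
  have hdi : ∀ t (i : {i // i ∈ Oᶜ}),
      Integrable (fun ω => g t (Z i ω).1 - fs (Z i ω).1) Pr := fun t i =>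
    ((hI.memL2 i i.2 _ (hg t).1).integrable one_le_two).comp_measurable (hξ i)
  let J' : Finset {i // i ∈ Oᶜ} := J.subtype (· ∈ Oᶜ)
  have hJ' : J'.map (Function.Embedding.subtype (· ∈ Oᶜ)) = J := by
    rw [Finset.subtype_map, Finset.filter_true_of_mem fun i hi => hJO hi]
  have hrad := sum_signs_integral_iSup_le (J := J') hc hg hdi (by rw [hJ']; exact hcomp)
  have : Nonempty {k // k ∈ cleanBlocks B O} := hn.to_subtype
  have key := measureReal_exists_sum_ramp_gt_le (ξ := fun i : {i // i ∈ Oᶜ} => Z i) hξ hI.indep hb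
    hbq hNK (h := fun t => lossDiff ℓ (g t) fs) (d := fun t z => g t z.1 - fs z.1) hlm
    (m := fun t => excessRisk P ℓ (g t) fs) (fun t i => (hLp t i).comp_of_map (hξ i).aemeasurable)
    hdi (fun t i => by
      rw [← hI.excessRisk_eq i i.2 _ (hg t).1, excessRisk,
        integral_map (hξ i).aemeasurable (hlm t).aestronglyMeasurable])
    (v := L ^ 2 * R ^ 2) (fun t i => by
      have h1 := integral_sq_lossDiff_le hloss (hFmeas _ (hg t).1) (hFmeas fs hfs)
        (hFval _ (hg t).1) (hFval fs hfs) (hI.memL2 i i.2 _ (hg t).1)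
      rw [integral_map (hξ i).aemeasurable ((hlm t).pow_const 2).aestronglyMeasurable,
        ← hI.l2Dist_eq i i.2 _ (hg t).1] at h1
      refine h1.trans ?_
      have := (hg t).2
      have := l2Dist_nonneg (Q := P) (f := g t) (g := fs)
      gcongr) hL.le hs (fun z t u => by
      have := abs_lossDiff_le hloss (hFval _ (hg t).1) (hFval _ (hg u).1) z
      simpa [lossDiff] using this) (J := J') (fun k i hi =>
        Finset.mem_subtype.2 (hJ k k.2 (Finset.mem_subtype.1 hi))) hrad hδ
  rw [Fintype.card_coe] at key
  have hsum : ∀ ω t, rampSum P ℓ fs B (cleanBlocks B O) s (fun i => Z i ω) (g t) =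
      ∑ k, ramp s (centeredMean (fun i : {i // i ∈ Oᶜ} => Z i) b (N / K) (lossDiff ℓ (g t) fs)
        (excessRisk P ℓ (g t) fs) k ω) := by
    intro ω t
    rw [rampSum, ← Finset.sum_coe_sort]
    refine Finset.sum_congr rfl fun k _ => ?_
    rw [centeredMean, blockMean, hB.card_eq,
      Finset.sum_subtype_of_mem (fun i => lossDiff ℓ (g t) fs (Z i ω)) (hBO k k.2)]
  simpa only [hsum] using key

/-- The deviation bound for a countable subclass. -/
lemma AreInliers.measureReal_rampSum_gt_le_of_countable (hL : 0 < L)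
    (hloss : IsLipschitzConvexLoss Ybar ℓ L)
    (hFmeas : ∀ f ∈ F, Measurable f) (hFval : ∀ f ∈ F, ∀ x, f x ∈ Ybar) (hfs : fs ∈ F)
    (hI : AreInliers Pr P ℓ F fs Z Oᶜ) (hB : AreBlocks B) (hNK : 0 < N / K)
    (hn : (cleanBlocks B O).Nonempty) {J : Finset (Fin N)} (hJO : J ⊆ Oᶜ)
    (hJ : ∀ k ∈ cleanBlocks B O, B k ⊆ J) {R c s δ : ℝ} (hc : 0 ≤ c) (hs : 0 < s)
    (hδ : 0 ≤ δ) (hcomp : rademacherComplexity Pr P F fs Z J R ≤ ENNReal.ofReal c)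
    {G : Set (𝒳 → ℝ)} (hGc : G.Countable) (hG : ∀ f ∈ G, f ∈ F ∧ l2Dist P f fs ≤ R) :
    Pr.real {ω | ∃ f ∈ G, (cleanBlocks B O).card *
      (L ^ 2 * R ^ 2 / ((N / K : ℕ) * s ^ 2) + δ) + 8 * L / (s * (N / K : ℕ)) * c <
        rampSum P ℓ fs B (cleanBlocks B O) s (fun i => Z i ω) f} ≤
      Real.exp (-(2 * (cleanBlocks B O).card * δ ^ 2)) := by
  have := hGc.to_subtype
  let U (T : Finset G) : Set Ω := {ω | ∃ t : T, (cleanBlocks B O).card *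
      (L ^ 2 * R ^ 2 / ((N / K : ℕ) * s ^ 2) + δ) + 8 * L / (s * (N / K : ℕ)) * c <
        rampSum P ℓ fs B (cleanBlocks B O) s (fun i => Z i ω) (t : G)}
  have hU : Monotone U := fun S T hST ω ⟨t, ht⟩ => ⟨⟨t, hST t.2⟩, ht⟩
  have hunion : {ω | ∃ f ∈ G, (cleanBlocks B O).card *
      (L ^ 2 * R ^ 2 / ((N / K : ℕ) * s ^ 2) + δ) + 8 * L / (s * (N / K : ℕ)) * c <
        rampSum P ℓ fs B (cleanBlocks B O) s (fun i => Z i ω) f} = ⋃ T, U T := by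
    ext ω
    simp only [Set.mem_ofPred_eq, Set.mem_iUnion, U]
    constructor
    · rintro ⟨f, hf, h⟩
      exact ⟨{⟨f, hf⟩}, ⟨⟨f, hf⟩, Finset.mem_singleton_self _⟩, h⟩
    · rintro ⟨T, t, h⟩
      exact ⟨_, t.1.2, h⟩
  -- Continuity from below along the countably many finite subclasses; the bound does not depend on
  -- their size.
  rw [hunion, measureReal_def, hU.directed_le.measure_iUnion]
  refine ENNReal.toReal_le_of_le_ofReal (Real.exp_pos _).le (iSup_le fun T => ?_)
  rw [← ENNReal.ofReal_toReal (measure_ne_top Pr (U T))]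
  exact ENNReal.ofReal_le_ofReal (hI.measureReal_rampSum_gt_le hL hloss hFmeas hFval hfs hB hNK hn
    hJO hJ hc hs hδ hcomp fun t => hG _ t.1.2)

/-- If the sum of the truncated deviations over the clean blocks is small, a majority of all the
blocks have a small deviation. -/
lemma lt_card_of_rampSum_le {s : ℝ} (hs : 0 < s) {z : Fin N → 𝒳 × 𝒴} {f : 𝒳 → ℝ}
    (hn : 4 * K ≤ 7 * (cleanBlocks B O).card) (hpos : 0 < (cleanBlocks B O).card)
    (h : rampSum P ℓ fs B (cleanBlocks B O) s z f ≤ 3 / 25 * (cleanBlocks B O).card) :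
    K < 2 * (Finset.univ.filter fun k =>
      |blockMean B z (lossDiff ℓ f fs) k - excessRisk P ℓ f fs| ≤ s).card := by
  let W : Fin K → ℝ := fun k => blockMean B z (lossDiff ℓ f fs) k - excessRisk P ℓ f fs
  -- Each block deviating by more than `s` contributes exactly `1` to the ramp sum.
  have h1 : (((cleanBlocks B O).filter fun k => ¬ |W k| ≤ s).card : ℝ) ≤
      rampSum P ℓ fs B (cleanBlocks B O) s z f := by
    rw [Finset.card_eq_sum_ones, Nat.cast_sum, Finset.sum_filter]
    refine Finset.sum_le_sum fun k _ => ?_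
    split_ifs with hk
    · exact ramp_nonneg _ _
    · rw [Nat.cast_one, ramp_eq_one hs (not_le.1 hk).le]
  have h2 := Finset.card_filter_add_card_filter_not (s := cleanBlocks B O) fun k => |W k| ≤ s
  have h3 : ((cleanBlocks B O).filter fun k => |W k| ≤ s).card ≤
      (Finset.univ.filter fun k => |W k| ≤ s).card :=
    Finset.card_le_card (Finset.filter_subset_filter _ (Finset.subset_univ _))
  have h4 : 25 * ((cleanBlocks B O).filter fun k => ¬ |W k| ≤ s).card ≤
      3 * (cleanBlocks B O).card := by
    have : (25 : ℝ) * ((cleanBlocks B O).filter fun k => ¬ |W k| ≤ s).card ≤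
      3 * (cleanBlocks B O).card := by linarith
    exact_mod_cast this
  -- With `n` clean blocks, twice the number of good ones is at least `44n/25`, which exceeds `7n/4
  -- ≥ K`.
  have h5 : K < 2 * (Finset.univ.filter fun k => |W k| ≤ s).card := by omega
  exact h5

/-- The threshold for the truncated deviations is below an eighth of the number of clean blocks. -/
lemma deviation_threshold_le {A L C n q N K j : ℝ} (hA : 0 < A) (hL : 0 < L) (hC : 0 < C)
    (hn : 0 ≤ n) (hq : 0 < q) (hK : 0 < K) (hNC : 864 * A ^ 2 * L ^ 2 * (K / N) ≤ C) (hN : 0 < N)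
    (hNq : N ≤ 2 * (K * q)) (hj : 4 * j ≤ 7 * (n * q)) :
    n * (L ^ 2 * C / (q * (C / (3 * A)) ^ 2) + 1 / 48) +
      8 * L / (C / (3 * A) * q) * ((101 / 100) ^ 2 * C * j * (1 / (575 * A * L))) ≤
      3 / 25 * n := by
  -- The variance term equals `9A²L² / (qC)`, and `864 / 2 = 9 · 48`, where the `2` is the loss in
  -- `N ≤ 2Kq`.
  have h1 : L ^ 2 * C / (q * (C / (3 * A)) ^ 2) ≤ 1 / 48 := by
    have e : L ^ 2 * C / (q * (C / (3 * A)) ^ 2) = 9 * A ^ 2 * L ^ 2 / (q * C) := by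
      field_simp
      ring
    rw [e, div_le_div_iff₀ (by positivity) (by norm_num)]
    have h2 : 864 * A ^ 2 * L ^ 2 * K ≤ C * N := by
      rw [← mul_div_assoc, div_le_iff₀ hN] at hNC
      exact hNC
    have h3 : C * N ≤ C * (2 * (K * q)) := by gcongr
    have h4 : 432 * A ^ 2 * L ^ 2 ≤ q * C := by
      refine le_of_mul_le_mul_left (a := 2 * K) ?_ (by positivity)
      linarith
    linarith
  -- The complexity term is at most `(24/575)(1.01)²(7/4) n < 0.075 n`; with `2/48 < 0.042` from the
  -- other two terms, the total stays below `0.12 n`.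
  have h2 : 8 * L / (C / (3 * A) * q) * ((101 / 100) ^ 2 * C * j * (1 / (575 * A * L))) =
      24 / 575 * (101 / 100) ^ 2 * (j / q) := by
    field_simp
    ring
  have h3 : j / q ≤ 7 / 4 * n := by
    rw [div_le_iff₀ hq]
    linarith
  rw [h2]
  nlinarith

end Main

theorem theorem3p1
    {Ω 𝒳 𝒴 : Type*} [MeasurableSpace Ω] [MeasurableSpace 𝒳] [MeasurableSpace 𝒴]
    (Pr : Measure Ω) [IsProbabilityMeasure Pr]
    (P : Measure (𝒳 × 𝒴)) [IsProbabilityMeasure P]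
    -- the loss and the class
    (Ybar : Set ℝ) (ℓ : ℝ → 𝒴 → ℝ) (L : ℝ) (hL : 0 < L)
    (hloss : IsLipschitzConvexLoss Ybar ℓ L)
    (F : Set (𝒳 → ℝ)) (hFmeas : ∀ f ∈ F, Measurable f) (hFval : ∀ f ∈ F, ∀ x, f x ∈ Ybar)
    (hFconv : Convex ℝ F) (hFsep : IsSeparableClass P F)
    (fs : 𝒳 → ℝ) (hfs : IsOracle P ℓ F fs) (hFL2 : ∀ f ∈ F, SubMemL2 P f fs)
    -- the data: outliers are indexed by `O`, inliers by its complement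
    (N : ℕ) (Z : Fin N → Ω → 𝒳 × 𝒴) (O : Finset (Fin N))
    (hO : (O.card : ℝ) ≤ 3 * N / 7)
    (hI : AreInliers Pr P ℓ F fs Z Oᶜ)
    -- the number of blocks and the blocks
    (K : ℕ) (hK1 : 1 ≤ K) (hKO : 7 * (O.card : ℝ) / 3 ≤ K) (hKN : K ≤ N)
    (B : Fin K → Finset (Fin N)) (hB : AreBlocks B)
    -- the complexity parameter and the local Bernstein condition
    (A : ℝ) (hA : 0 < A)
    (r₂ : ℝ) (hr₂ : IsComplexityParameter Pr P F fs Z Oᶜ (1 / (575 * A * L)) r₂)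
    (hBern : LocalBernstein P ℓ F fs A (squaredRadius A L K N r₂)) :
    ∃ E : Set Ω, MeasurableSet E ∧ 1 - Real.exp (-(K : ℝ) / 2016) ≤ Pr.real E ∧
      ∀ ω ∈ E, ∀ fhat : 𝒳 → ℝ, IsMinmaxMOM ℓ F B (fun i => Z i ω) fhat →
        l2Dist P fhat fs ^ 2 ≤ squaredRadius A L K N r₂ ∧
        excessRisk P ℓ fhat fs ≤ 2 / (3 * A) * squaredRadius A L K N r₂ := by
  obtain ⟨F₀, hF₀F, hF₀c, hdense⟩ := hFsep
  set C := squaredRadius A L K N r₂ with hCdef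
  have hKpos : (0 : ℝ) < K := by exact_mod_cast hK1
  have hNpos : (0 : ℝ) < N := by exact_mod_cast hK1.trans hKN
  have hCK : 864 * A ^ 2 * L ^ 2 * ((K : ℝ) / N) ≤ C := le_max_right _ _
  have hC : 0 < C := lt_of_lt_of_le (by positivity) hCK
  have hR : 0 < √C := Real.sqrt_pos.2 hC
  have hr₂R : r₂ ≤ √C := Real.le_sqrt_of_sq_le (le_max_left _ _)
  have hON : 7 * O.card ≤ 3 * N := by
    have : (7 : ℝ) * O.card ≤ 3 * N := by linarith
    exact_mod_cast this
  have hOK : 7 * O.card ≤ 3 * K := by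
    have : (7 : ℝ) * O.card ≤ 3 * K := by linarith
    exact_mod_cast this
  have hclean := le_card_cleanBlocks_add (O := O) hB
  have hn4 : 4 * K ≤ 7 * (cleanBlocks B O).card := by omega
  have hn : 0 < (cleanBlocks B O).card := by omega
  have hq : 0 < N / K := Nat.div_pos hKN hK1
  have hNq : N ≤ 2 * (K * (N / K)) := by
    have h1 := Nat.div_add_mod N K
    have h2 := Nat.mod_lt N hK1
    have h3 : K ≤ K * (N / K) := Nat.le_mul_of_pos_right K hq
    omega
  obtain ⟨J, hJO, hBJ, hNJ, hJn⟩ := exists_superset_cleanBlocks (O := O) hB hK1 hKN hON hOK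
  -- The one percent of slack in the radius pays for an infimum that is not attained.
  have hcomp := hr₂.rademacherComplexity_le hFconv hfs.1 (by positivity) hR hr₂R
    (R' := 101 / 100 * √C) (by linarith) hJO (by
      have : (N : ℝ) ≤ 2 * J.card := by exact_mod_cast hNJ
      linarith)
  rw [mul_pow, Real.sq_sqrt hC.le] at hcomp
  have hs : 0 < C / (3 * A) := by positivity
  have hthr := deviation_threshold_le (n := (cleanBlocks B O).card) (q := (N / K : ℕ)) (N := N)
    (K := K) (j := J.card) hA hL hC (Nat.cast_nonneg _) (by exact_mod_cast hq) hKpos hCK hNpos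
    (by exact_mod_cast hNq) (by exact_mod_cast hJn)
  let G : Set (𝒳 → ℝ) := {f ∈ F₀ | l2Dist P f fs ≤ √C}
  have hGc : G.Countable := hF₀c.mono fun f hf => hf.1
  -- `δ = 1/48` gives the exponent `2n/48² = n/1152`, and `n ≥ 4K/7` turns it into `K/2016`.
  have hdev := hI.measureReal_rampSum_gt_le_of_countable hL hloss hFmeas hFval hfs.1 hB hq
    (Finset.card_pos.1 hn) hJO hBJ (by positivity) hs (δ := 1 / 48) (by norm_num) hcomp hGc
    fun f hf => ⟨hF₀F hf.1, hf.2⟩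
  rw [Real.sq_sqrt hC.le] at hdev
  -- A countable intersection, hence measurable; density extends the bound to the whole ball at each
  -- `ω ∈ E`.
  let E : Set Ω := ⋂ f ∈ G, {ω | rampSum P ℓ fs B (cleanBlocks B O) (C / (3 * A))
    (fun i => Z i ω) f ≤ 3 / 25 * (cleanBlocks B O).card}
  have hE : MeasurableSet E := MeasurableSet.biInter hGc fun f hf =>
    measurableSet_le (hI.measurable_rampSum hloss hFmeas hFval hfs.1 _ (hF₀F hf.1))
      measurable_const
  refine ⟨E, hE, ?_, fun ω hω fhat hfhat => ?_⟩
  · have h1 : Pr.real Eᶜ ≤ Real.exp (-(K : ℝ) / 2016) := by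
      refine (measureReal_mono fun ω hω => ?_).trans (hdev.trans (Real.exp_le_exp.2 ?_))
      · simp only [E, Set.mem_compl_iff, Set.mem_iInter, not_forall] at hω
        obtain ⟨f, hf, h⟩ := hω
        exact ⟨f, hf, hthr.trans_lt (not_le.1 h)⟩
      · have : (4 : ℝ) * K ≤ 7 * (cleanBlocks B O).card := by exact_mod_cast hn4
        linarith
    rw [probReal_compl_eq_one_sub hE] at h1
    linarith
  · refine hfhat.localized hloss hFval hFconv hfs hA hC hBern fun f hf hfC => ?_
    refine lt_card_of_rampSum_le hs hn4 hn (rampSum_le_of_dense hL.le hloss hFmeas hFval hFconv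
      hFL2 hfs.1 hF₀F hdense hR (fun f hf hfR => ?_) f hf (Real.le_sqrt_of_sq_le hfC))
    exact Set.mem_iInter₂.1 hω f ⟨hf, hfR⟩
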